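/- All graphs are finite and simple. For a graph $G$ let $d_G$ denote the distance, with $d_G(u,v)=\infty$ if $u,v$ lie in different components. A $k$-term arithmetic progression ($k$-AP) in $G$ is a list $(v_1,\dots,v_k)$ of vertices such that, for some non-negative integer $d$, $d_G(v_i,v_{i+1})=d$ for $1\le i<k$; it is rainbow under a coloring $c$ if $c(v_1),\dots,c(v_k)$ are distinct. The anti-van der Waerden number $\mathrm{aw}(G,k)$ is the least $r\ge 1$ such that every surjective map $c:V(G)\to\{1,\dots,r\}$ admits a rainbow $k$-AP. A vertex of a connected graph is peripheral if its eccentricity equals the diameter. A graph $G$ is $3$-peripheral if it has three distinct vertices pairwise at distance $\mathrm{diam}(G)$. For a tree $T$ and a peripheral vertex $v$ let $T_{v^-}$ be obtained from $T$ by deleting all vertices at distance $\mathrm{diam}(T)$ from $v$; for any vertex $u$ let $T_{u^+}$ be obtained from $T$ by attaching a new leaf to $u$. A tree $T$ with at least two vertices is weakly non-$3$-peripheral if it is not $3$-peripheral and either $\mathrm{diam}(T)$ is odd and $T_{v^-}$ is $3$-peripheral for every peripheral vertex $v$, or $\mathrm{diam}(T)$ is even and $T_{u^+}$ is $3$-peripheral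 for some vertex $u$. For trees $T,T'$ with at least two vertices each, let $(\ast)$ be the condition that at least one of the following holds: (i) $T$ or $T'$ is $3$-peripheral; (ii) $\mathrm{diam}(T\square T')$ is even and $T$ or $T'$ is isomorphic to the path $P_2$ on two vertices; (iii) $\mathrm{diam}(T\square T')$ is even and $T$ or $T'$ is weakly non-$3$-peripheral. Theorem. Let $F_1$ and $F_2$ be forests without isolated vertices. Let $P$ be the set of connected components $C$ of the Cartesian product $F_1\square F_2$ with $\mathrm{aw}(C,3)=3$, and $S$ the set of those with $\mathrm{aw}(C,3)=4$. Then \[\mathrm{aw}(F_1\square F_2,3)=2|P|+3|S|+1 .\] Moreover, for $x\in V(F_1)$ and $y\in V(F_2)$ let $T$ and $T'$ be the components of $F_1$ and $F_2$ that contain $x$ and $y$; then the component of $F_1\square F_2$ containing $(x,y)$ belongs to $P$ if and only if $(T,T')$ satisfies $(\ast)$, and to $S$ if and only if $(T,T')$ does not satisfy $(\ast)$. Consequently $|P|$ is the number of pairs $(T,T')$, with $T$ a component of $F_1$ and $T'$ a component of $F_2$, that satisfy $(\ast)$, and $|S|$ is the number of such pairs that do not. -/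

import Mathlib

namespace SimpleGraph

variable {V W : Type*}

/-- A list of `k` vertices is an arithmetic progression in `G` if there is a (finite) common
difference `d` such that any two consecutive vertices are at distance exactly `d`.  The extended
distance is used, so that vertices in different components are at no finite distance. -/
def IsAP (G : SimpleGraph V) {k : ℕ} (v : Fin k → V) : Prop :=
  ∃ d : ℕ, ∀ i j : Fin k, (j : ℕ) = i + 1 → G.edist (v i) (v j) = d

/-- The coloring `c` (not necessarily proper) has a rainbow `k`-term arithmetic progression. -/
def HasRainbowAP (G : SimpleGraph V) {r : ℕ} (c : V → Fin r) (k : ℕ) : Prop :=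
  ∃ v : Fin k → V, G.IsAP v ∧ Function.Injective (c ∘ v)

/-- The anti-van der Waerden number `aw(G, k)`: the least positive `r` such that every exact
(i.e. surjective) `r`-coloring of the vertices of `G` has a rainbow `k`-term arithmetic
progression.  For a finite `G` every `r` exceeding the number of vertices qualifies. -/
noncomputable def antiVanDerWaerden (G : SimpleGraph V) (k : ℕ) : ℕ :=
  sInf {r : ℕ | 0 < r ∧ ∀ c : V → Fin r, Function.Surjective c → G.HasRainbowAP c k}

/-- A vertex is peripheral if its eccentricity is the diameter. -/
def IsPeripheral (G : SimpleGraph V) (v : V) : Prop :=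
  G.eccent v = G.ediam

/-- `G` contains `n` distinct vertices that are pairwise at distance `diam G`. -/
def IsNPeripheral (G : SimpleGraph V) (n : ℕ) : Prop :=
  ∃ u : Fin n → V, Function.Injective u ∧ ∀ i j : Fin n, i ≠ j → G.dist (u i) (u j) = G.diam

/-- The graph obtained from `T` by removing all vertices at distance `diam T` from `v`. -/
def removeDiametral (T : SimpleGraph V) (v : V) : SimpleGraph {w : V // T.dist v w ≠ T.diam} :=
  T.comap Subtype.val

/-- The graph obtained from `T` by adding a new vertex (namely `none`) adjacent to `u` only. -/
def addLeaf (T : SimpleGraph V) (u : V) : SimpleGraph (Option V) :=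
  T.map (Function.Embedding.some : V ↪ Option V) ⊔ edge none (some u)

/-- A (nontrivial) tree `T` that is not 3-peripheral is weakly non-3-peripheral if, in case its
diameter is odd, `T.removeDiametral v` is 3-peripheral for every peripheral `v`, and, in case its
diameter is even, `T.addLeaf u` is 3-peripheral for some `u`. -/
def IsWeaklyNonThreePeripheral (T : SimpleGraph V) : Prop :=
  ¬ T.IsNPeripheral 3 ∧
    ((Odd T.diam ∧ ∀ v : V, T.IsPeripheral v → (T.removeDiametral v).IsNPeripheral 3) ∨
      (Even T.diam ∧ ∃ u : V, (T.addLeaf u).IsNPeripheral 3))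

/-- The condition on a pair of nontrivial trees in the first case of the classification. -/
def ThreeCase (T : SimpleGraph V) (T' : SimpleGraph W) : Prop :=
  (T.IsNPeripheral 3 ∨ T'.IsNPeripheral 3) ∨
    (Even (T □ T').diam ∧ (Nonempty (T ≃g pathGraph 2) ∨ Nonempty (T' ≃g pathGraph 2))) ∨
    (Even (T □ T').diam ∧ (T.IsWeaklyNonThreePeripheral ∨ T'.IsWeaklyNonThreePeripheral))

/-- The set of connected components of `G`, as graphs of their own, with `aw(·, 3) = m`. -/
def componentsWithAW (G : SimpleGraph V) (m : ℕ) : Set G.ConnectedComponent :=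
  {C | C.toSimpleGraph.antiVanDerWaerden 3 = m}

end SimpleGraph

/-! Everything rests on the largest number of colors in a coloring without rainbow 3-APs, which is
one less than the anti-van der Waerden number. A 3-AP stays inside one component, and components
keep their distances, so components can be colored independently with disjoint palettes and the
maxima add up. A component of the product is a product of two nontrivial trees, and two colors are
always harmless. It remains to show that such a product never admits four colors, and admits three
exactly when `ThreeCase` fails.

Given at least three colors, take the least distance `k` from a vertex to an edge whose ends have
two further colors. This yields a good pair `r`, `b` at distance `k + 1`, with a third color `ω`
between them. Minimality and rainbow-freeness force every vertex within `k` of `r` to have color `ω`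
or `c r`, likewise for `b`, and make `k` even. In a product of trees, `b` can be moved over the
whole sphere of radius `k + 1` around `r` without changing its color (`GoodPair.sphere`), and no
good pair shares a coordinate (`GoodPair.snd_ne`). Hence there is no fourth color, and a good pair
can be moved until its first coordinates are diametral. A third point at diametral distance from
both is then impossible. If the diameter of the product is even, parity leaves room in the second
factor and forces the pair to be `Slim`; by symmetry the same holds for the other factor.

Conversely, without diametral triples and, for even diameter, with slim pairs in both factors, color
one class around a corner `(s, t)`, then the sphere of the largest odd radius around `(s, t)`, then
the rest (`rainbowFree_of_spheres`). Finally, `IsTree.exists_slim_iff` translates slimness into the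
conditions on removing and adding leaves. -/

/-- The distance function of a connected bipartite graph, seen abstractly. -/
structure IsBipDist {X : Type*} (δ : X → X → ℕ) : Prop where
  eq_zero : ∀ {x y}, δ x y = 0 ↔ x = y
  symm : ∀ x y, δ x y = δ y x
  triangle : ∀ x y z, δ x z ≤ δ x y + δ y z
  geod : ∀ {x y i j}, δ x y = i + j → ∃ z, δ x z = i ∧ δ z y = j
  parity : ∀ x y z, Even (δ x y + δ y z + δ x z)

/-- The distance function of a tree: it satisfies the four-point condition. -/
structure IsTreeDist {X : Type*} (δ : X → X → ℕ) : Prop extends IsBipDist δ where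
  four : ∀ a b c e, δ a b + δ c e ≤ max (δ a c + δ b e) (δ a e + δ b c)

/-- Any three vertices of which the second is equidistant from the others repeat a color. -/
def RainbowFree {X κ : Type*} (δ : X → X → ℕ) (c : X → κ) : Prop :=
  ∀ u v w, δ u v = δ v w → c u = c v ∨ c v = c w ∨ c u = c w

/-- A rainbow-free coloring in which every vertex is at distance at least `k` from all edges whose
ends have two further colors. -/
structure GapColoring {X κ : Type*} (δ : X → X → ℕ) (c : X → κ) (k : ℕ) : Prop where
  bip : IsBipDist δ
  rainbowFree : RainbowFree δ c
  gap : ∀ {x y z}, δ x y = 1 → c x ≠ c y → c z ≠ c x → c z ≠ c y → k ≤ δ z x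

/-- The vertices `r` and `b` have different colors, are at distance `k + 1`, and `b` has a neighbor
of a third color `ω` at distance `k` from `r`. -/
structure GoodPair {X κ : Type*} (δ : X → X → ℕ) (c : X → κ) (k : ℕ) (ω : κ) (r b : X) : Prop where
  ne : c r ≠ c b
  left : ω ≠ c r
  right : ω ≠ c b
  dist : δ r b = k + 1
  neighbor : ∃ x, c x = ω ∧ δ x b = 1 ∧ δ r x = k

/-! ### Good pairs in an abstract bipartite distance -/

namespace GapColoring

variable {X κ : Type*} {δ : X → X → ℕ} {c : X → κ} {k : ℕ} {ω : κ} {r b : X}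

theorem gap_right (H : GapColoring δ c k) {x y z : X} (h : δ x y = 1) (hxy : c x ≠ c y)
    (hx : c z ≠ c x) (hy : c z ≠ c y) : k ≤ δ z y :=
  H.gap (by rw [H.bip.symm]; exact h) hxy.symm hy hx

/-- On a geodesic from `r` to `x`, a vertex of color other than `ω` and `c b` would be too close to
the edge `x b`. One of color `c b` would create an edge too close to `x` (at the first step) or to
`r` (later). -/
theorem interval (H : GapColoring δ c k) {x : X} (hx : c x = ω) (hxb : δ x b = 1)
    (hrx : δ r x = k) (hrb : c r ≠ c b) (hr : ω ≠ c r) (hb : ω ≠ c b) :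
    ∀ i, ∀ v, δ r v = i + 1 → δ r v + δ v x = k → c v = ω := by
  subst hx
  intro i
  induction i with
  | zero =>
    intro v hv hvx
    by_contra hne
    have h1 : c v = c b := by
      by_contra h
      have := H.gap hxb hb hne h
      omega
    have h2 := H.gap_right (x := r) (y := v) (z := x) hv (by rw [h1]; exact hrb) hr
      (by rw [h1]; exact hb)
    have := H.bip.symm x v
    omega
  | succ i ih =>
    intro v hv hvx
    obtain ⟨u, hu, huv⟩ := H.bip.geod hv
    have t1 := H.bip.triangle r u x
    have t2 := H.bip.triangle u v x
    have hcu := ih u hu (by omega)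
    by_contra hne
    have h1 : c v = c b := by
      by_contra h
      have := H.gap hxb hb hne h
      omega
    have := H.gap (x := u) (y := v) (z := r) huv (by rw [hcu, h1]; exact hb)
      (by rw [hcu]; exact hr.symm) (by rw [h1]; exact hrb)
    omega

end GapColoring

namespace GoodPair

variable {X κ : Type*} {δ : X → X → ℕ} {c : X → κ} {k : ℕ} {ω : κ} {r b : X}

theorem two_le (H : GapColoring δ c k) (h : GoodPair δ c k ω r b) : 2 ≤ k := by
  obtain ⟨x, hx, hxb, hrx⟩ := h.neighbor
  by_contra hk
  have : k = 0 ∨ k = 1 := by omega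
  rcases this with rfl | rfl
  · rw [H.bip.eq_zero] at hrx
    subst hrx
    exact h.left hx.symm
  · have := H.rainbowFree r x b (by omega)
    have h1 := h.left
    have h2 := h.right
    have h3 := h.ne
    subst hx
    rcases this with h | h | h
    · exact h1 h.symm
    · exact h2 h
    · exact h3 h

theorem exists_neighbor (H : GapColoring δ c k) (h : GoodPair δ c k ω r b) :
    ∃ z, c z = ω ∧ δ r z = 1 ∧ δ z b = k := by
  have hk := h.two_le H
  obtain ⟨x, hx, hxb, hrx⟩ := h.neighbor
  obtain ⟨z, hz, hzx⟩ := H.bip.geod (x := r) (y := x) (i := 1) (j := k - 1) (by omega)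
  have := H.bip.triangle z x b
  have := H.bip.triangle r z b
  have := h.dist
  exact ⟨z, H.interval hx hxb hrx h.ne h.left h.right 0 z hz (by omega), hz, by omega⟩

theorem symm (H : GapColoring δ c k) (h : GoodPair δ c k ω r b) : GoodPair δ c k ω b r := by
  obtain ⟨z, hz, hrz, hzb⟩ := h.exists_neighbor H
  have := H.bip.symm r b
  have := H.bip.symm r z
  have := H.bip.symm z b
  have := h.dist
  exact ⟨h.ne.symm, h.right, h.left, by omega, z, hz, by omega, by omega⟩

/-- A vertex of another color lies at distance at least `k` from `b` by the gap; at distance exactly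
`k` it forms a rainbow progression with `b` and the `ω`-colored neighbor of `r`. -/
theorem color_of_le_right (H : GapColoring δ c k) (h : GoodPair δ c k ω r b) {v : X}
    (hv : δ v b ≤ k) : c v = ω ∨ c v = c b := by
  obtain ⟨z, hz, hrz, hzb⟩ := h.exists_neighbor H
  obtain ⟨x, hx, hxb, hrx⟩ := h.neighbor
  by_contra! hne
  have h1 := h.right
  have h2 := H.gap_right (z := v) hxb (by rw [hx]; exact h1) (by rw [hx]; exact hne.1) hne.2
  have h3 := H.bip.symm z b
  rcases H.rainbowFree v b z (by omega) with h | h | h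
  · exact hne.2 h
  · exact h1 (by rw [← hz, h])
  · exact hne.1 (by rw [h, hz])

theorem color_of_le_left (H : GapColoring δ c k) (h : GoodPair δ c k ω r b) {v : X}
    (hv : δ r v ≤ k) : c v = ω ∨ c v = c r :=
  (h.symm H).color_of_le_right H (by rw [H.bip.symm]; exact hv)

theorem color_of_le (H : GapColoring δ c k) (h : GoodPair δ c k ω r b) {v : X}
    (hr : δ r v ≤ k) (hb : δ v b ≤ k) : c v = ω := by
  rcases h.color_of_le_left H hr with h1 | h1
  · exact h1
  · rcases h.color_of_le_right H hb with h2 | h2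
    · exact h2
    · exact absurd (h1.symm.trans h2) h.ne

theorem color_of_eq_left (H : GapColoring δ c k) (h : GoodPair δ c k ω r b) {v : X}
    (hv : δ r v = k + 1) : c v = c r ∨ c v = c b := by
  have h1 := h.dist
  have h2 := H.bip.symm r v
  rcases H.rainbowFree v r b (by omega) with h' | h' | h'
  · exact Or.inl h'
  · exact absurd h' h.ne
  · exact Or.inr h'

theorem color_of_eq_right (H : GapColoring δ c k) (h : GoodPair δ c k ω r b) {v : X}
    (hv : δ v b = k + 1) : c v = c r ∨ c v = c b :=
  ((h.symm H).color_of_eq_left H (by rw [H.bip.symm]; exact hv)).symm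

/-- For odd `k` the pair has a midpoint, which is colored `ω`, and this gives a rainbow progression.
-/
theorem even (H : GapColoring δ c k) (h : GoodPair δ c k ω r b) : Even k := by
  by_contra hodd
  have hk := h.two_le H
  obtain ⟨j, hj⟩ := Nat.not_even_iff_odd.mp hodd
  obtain ⟨m, h1, h2⟩ := H.bip.geod (x := r) (y := b) (i := j + 1) (j := j + 1)
    (by rw [h.dist]; omega)
  have hm := h.color_of_le H (v := m) (by omega) (by omega)
  rcases H.rainbowFree r m b (by omega) with h' | h' | h'
  · exact h.left (by rw [h', hm])
  · exact h.right (by rw [← h', hm])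
  · exact h.ne h'

/-- The elementary move on the sphere around `r`: `w` has color `ω`, so if `v` had color `c r`, then
`v, w, b` would be rainbow. -/
theorem of_common_neighbor (H : GapColoring δ c k) (h : GoodPair δ c k ω r b) {w v : X}
    (hrw : δ r w = k) (hwb : δ w b = 1) (hwv : δ w v = 1) (hrv : δ r v = k + 1) :
    GoodPair δ c k ω r v ∧ c v = c b := by
  have hk := h.two_le H
  have hw := h.color_of_le H (v := w) (by omega) (by omega)
  have hv : c v = c b := by
    rcases h.color_of_eq_left H hrv with hv | hv
    · have h1 := H.bip.symm w v
      rcases H.rainbowFree v w b (by omega) with h' | h' | h'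
      · exact absurd (by rw [← hw, ← h', hv]) h.left
      · exact absurd (by rw [← hw, h']) h.right
      · exact h'
    · exact hv
  exact ⟨⟨by rw [hv]; exact h.ne, h.left, by rw [hv]; exact h.right, hrv, w, hw, hwv, hrw⟩, hv⟩

end GoodPair

theorem IsBipDist.exists_bicolored_edge {X κ : Type*} {δ : X → X → ℕ} (hδ : IsBipDist δ)
    (c : X → κ) : ∀ n x y, δ x y = n → c x ≠ c y → ∃ u v, δ u v = 1 ∧ c u ≠ c v := by
  intro n
  induction n with
  | zero =>
    intro x y h hne
    rw [hδ.eq_zero] at h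
    exact absurd (by rw [h]) hne
  | succ n ih =>
    intro x y h hne
    obtain ⟨z, h1, h2⟩ := hδ.geod h
    by_cases hz : c x = c z
    · exact ⟨z, y, h2, by rw [← hz]; exact hne⟩
    · exact ih x z h1 hz

/-- A rainbow-free coloring with at least three colors has a good pair for some `k`. -/
theorem exists_goodPair {X κ : Type*} {δ : X → X → ℕ} (hδ : IsBipDist δ) {c : X → κ}
    (hc : RainbowFree δ c) {x₁ x₂ x₃ : X} (h₁₂ : c x₁ ≠ c x₂) (h₁₃ : c x₁ ≠ c x₃)
    (h₂₃ : c x₂ ≠ c x₃) :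
    ∃ k ω r b, GapColoring δ c k ∧ GoodPair δ c k ω r b := by
  classical
  obtain ⟨u, v, huv, hne⟩ := hδ.exists_bicolored_edge c _ x₁ x₂ rfl h₁₂
  obtain ⟨z, hzu, hzv⟩ : ∃ z, c z ≠ c u ∧ c z ≠ c v := by
    by_contra! h
    have e1 := h x₁
    have e2 := h x₂
    have e3 := h x₃
    by_cases f1 : c x₁ = c u
    · have f2 := e2 (by rw [← f1]; exact h₁₂.symm)
      have f3 := e3 (by rw [← f1]; exact h₁₃.symm)
      exact h₂₃ (f2.trans f3.symm)
    · by_cases f2 : c x₂ = c u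
      · exact h₁₃ ((e1 f1).trans (e3 (by rw [← f2]; exact h₂₃.symm)).symm)
      · exact h₁₂ ((e1 f1).trans (e2 f2).symm)
  have hex : ∃ k, ∃ x y z, δ x y = 1 ∧ c x ≠ c y ∧ c z ≠ c x ∧ c z ≠ c y ∧ δ z x = k :=
    ⟨_, u, v, z, huv, hne, hzu, hzv, rfl⟩
  obtain ⟨x, y, z, hxy, hne, hzx, hzy, hk⟩ := Nat.find_spec hex
  have H : GapColoring δ c (Nat.find hex) :=
    ⟨hδ, hc, fun h1 h2 h3 h4 => Nat.find_min' hex ⟨_, _, _, h1, h2, h3, h4, rfl⟩⟩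
  refine ⟨_, c x, z, y, H, hzy, hzx.symm, hne, ?_, x, rfl, hxy, hk⟩
  -- The distance from `z` to `y` is `k` or `k + 1`, and parity rules out `k`.
  have h1 := H.gap_right hxy hne hzx hzy
  have h2 := hδ.triangle z x y
  obtain ⟨m, h3⟩ := hδ.parity z x y
  omega

/-! ### Good pairs in products of trees -/

/-- The distance in a Cartesian product of graphs with distances `d` and `e`. -/
def prodDist {V W : Type*} (d : V → V → ℕ) (e : W → W → ℕ) (p q : V × W) : ℕ :=
  d p.1 q.1 + e p.2 q.2

theorem IsBipDist.prodDist {V W : Type*} {d : V → V → ℕ} {e : W → W → ℕ} (hd : IsBipDist d)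
    (he : IsBipDist e) : IsBipDist (prodDist d e) where
  eq_zero := by
    rintro ⟨a, b⟩ ⟨a', b'⟩
    simp [_root_.prodDist, hd.eq_zero, he.eq_zero]
  symm := by
    rintro ⟨a, b⟩ ⟨a', b'⟩
    simp only [_root_.prodDist]
    rw [hd.symm, he.symm]
  triangle := by
    rintro ⟨a, b⟩ ⟨a', b'⟩ ⟨a'', b''⟩
    have := hd.triangle a a' a''
    have := he.triangle b b' b''
    simp only [_root_.prodDist]
    omega
  geod := by
    rintro ⟨a, b⟩ ⟨a', b'⟩ i j h
    simp only [_root_.prodDist] at h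
    obtain ⟨x, h1, h2⟩ := hd.geod (x := a) (y := a') (i := min i (d a a'))
      (j := d a a' - min i (d a a')) (by omega)
    obtain ⟨y, h3, h4⟩ := he.geod (x := b) (y := b') (i := i - min i (d a a'))
      (j := e b b' - (i - min i (d a a'))) (by omega)
    refine ⟨(x, y), ?_, ?_⟩ <;> simp only [_root_.prodDist] <;> omega
  parity := by
    rintro ⟨a, b⟩ ⟨a', b'⟩ ⟨a'', b''⟩
    obtain ⟨m, hm⟩ := hd.parity a a' a''
    obtain ⟨n, hn⟩ := he.parity b b' b''
    exact ⟨m + n, by simp only [_root_.prodDist]; omega⟩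

theorem prodDist_swap {V W : Type*} (d : V → V → ℕ) (e : W → W → ℕ) (p q : W × V) :
    prodDist d e p.swap q.swap = prodDist e d p q := by
  simp [prodDist, add_comm]

section

variable {V W κ : Type*} {d : V → V → ℕ} {e : W → W → ℕ} {c : V × W → κ} {k : ℕ} {ω : κ}

theorem RainbowFree.swap (h : RainbowFree (prodDist d e) c) :
    RainbowFree (prodDist e d) (c ∘ Prod.swap) := fun u v w huvw =>
  h u.swap v.swap w.swap (by simpa only [prodDist_swap] using huvw)

theorem GapColoring.swap (hd : IsBipDist d) (he : IsBipDist e)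
    (H : GapColoring (prodDist d e) c k) : GapColoring (prodDist e d) (c ∘ Prod.swap) k where
  bip := he.prodDist hd
  rainbowFree := H.rainbowFree.swap
  gap := by
    intro x y z h1 h2 h3 h4
    have := H.gap (x := x.swap) (y := y.swap) (z := z.swap)
      (by rw [prodDist_swap]; exact h1) h2 h3 h4
    rwa [prodDist_swap] at this

theorem GoodPair.swap {r b : V × W} (h : GoodPair (prodDist d e) c k ω r b) :
    GoodPair (prodDist e d) (c ∘ Prod.swap) k ω r.swap b.swap where
  ne := by simpa using h.ne
  left := by simpa using h.left
  right := by simpa using h.right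
  dist := by rw [prodDist_swap]; exact h.dist
  neighbor := by
    obtain ⟨x, h1, h2, h3⟩ := h.neighbor
    exact ⟨x.swap, by simpa using h1, by rw [prodDist_swap]; exact h2,
      by rw [prodDist_swap]; exact h3⟩

theorem IsBipDist.exists_dist_eq_one [Nontrivial V] (hd : IsBipDist d) (x : V) :
    ∃ y, d x y = 1 := by
  obtain ⟨y, hy⟩ := exists_ne x
  have : d x y ≠ 0 := fun h => hy (hd.eq_zero.mp h).symm
  obtain ⟨z, hz, -⟩ := hd.geod (x := x) (y := y) (i := 1) (j := d x y - 1) (by omega)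
  exact ⟨z, hz⟩

/-- If the second coordinates agreed, pushing the two `ω`-neighbors `s₁`, `s₂` on a geodesic one
step aside to `t₁` would give vertices of colors `c r` and `c b`. These are only `k - 1` apart,
although one forms a good pair with `b` and has no vertex of color `c b` that near. -/
theorem GoodPair.snd_ne [Nontrivial W] (hd : IsBipDist d) (he : IsBipDist e)
    (H : GapColoring (prodDist d e) c k) {s s' : V} {t t' : W}
    (h : GoodPair (prodDist d e) c k ω (s, t) (s', t')) : t ≠ t' := by
  rintro rfl
  have hk := h.two_le H
  have hdist := h.dist
  have ht0 : e t t = 0 := he.eq_zero.mpr rfl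
  simp only [prodDist, ht0] at hdist
  obtain ⟨t₁, ht₁⟩ := he.exists_dist_eq_one t
  have ht₁' : e t₁ t = 1 := by rw [he.symm]; exact ht₁
  have ht₁₀ : e t₁ t₁ = 0 := he.eq_zero.mpr rfl
  obtain ⟨s₁, h1, h2⟩ := hd.geod (x := s) (y := s') (i := 1) (j := k) (by omega)
  obtain ⟨s₂, h3, h4⟩ := hd.geod (x := s₁) (y := s') (i := k - 1) (j := 1) (by omega)
  have t1 := hd.triangle s s₁ s₂
  have t2 := hd.triangle s s₂ s'
  have e1 := hd.symm s s₁
  have e2 := hd.symm s₁ s₂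
  have e3 := hd.symm s₂ s'
  have e4 := hd.symm s₁ s'
  have z1 : d s₁ s₁ = 0 := hd.eq_zero.mpr rfl
  have z2 : d s₂ s₂ = 0 := hd.eq_zero.mpr rfl
  obtain ⟨g1, c1⟩ := h.of_common_neighbor H (w := (s₂, t)) (v := (s₂, t₁))
    (by simp only [prodDist]; omega) (by simp only [prodDist]; omega)
    (by simp only [prodDist]; omega) (by simp only [prodDist]; omega)
  obtain ⟨g2, c2⟩ := (h.symm H).of_common_neighbor H (w := (s₁, t)) (v := (s₁, t₁))
    (by simp only [prodDist]; omega) (by simp only [prodDist]; omega)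
    (by simp only [prodDist]; omega) (by simp only [prodDist]; omega)
  have := (g2.symm H).color_of_le_left H (v := (s₂, t₁)) (by simp only [prodDist]; omega)
  rcases this with h' | h'
  · exact g1.right h'.symm
  · exact g1.ne (by rw [h', c2])

theorem GoodPair.fst_ne [Nontrivial V] (hd : IsBipDist d) (he : IsBipDist e)
    (H : GapColoring (prodDist d e) c k) {s s' : V} {t t' : W}
    (h : GoodPair (prodDist d e) c k ω (s, t) (s', t')) : s ≠ s' :=
  GoodPair.snd_ne he hd (H.swap hd he) h.swap

/-- On a geodesic between two points equidistant from `s`, the distance from `s` is determined. -/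
theorem IsTreeDist.dist_of_equidistant (hd : IsTreeDist d) {s s' x y : V} {m i : ℕ}
    (hx : d s x = d s s') (hm : d s' x = 2 * m) (hi : m ≤ i) (h1 : d s' y = i)
    (h2 : d s' y + d y x = 2 * m) : d s y + 2 * m = d s s' + i := by
  have f := hd.four s y s' x
  have := hd.symm y s'
  have := hd.triangle s y x
  omega

/-- The path from `s'` to `x` first approaches `s` and then recedes. If it has length at most `k`,
its last inner vertex is an `ω`-neighbor of `x`. If it is longer, the point at distance `k + 1` from
`s'` has color `c r` and forms a good pair with `(s', t')` in the same layer, against `snd_ne`. -/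
theorem GoodPair.fst_move [Nontrivial W] (hd : IsTreeDist d) (he : IsTreeDist e)
    (H : GapColoring (prodDist d e) c k) {s s' x : V} {t t' : W}
    (h : GoodPair (prodDist d e) c k ω (s, t) (s', t')) (hx : d s x = d s s') :
    GoodPair (prodDist d e) c k ω (s, t) (x, t') ∧ c (x, t') = c (s', t') := by
  by_cases hxs : s' = x
  · subst hxs
    exact ⟨h, rfl⟩
  have hk := h.two_le H
  obtain ⟨j, hj⟩ := h.even H
  have hdist := h.dist
  simp only [prodDist] at hdist
  -- This gives `d s s' ≤ k`, hence `m ≤ k`, so the points at distance `k` and `k + 1` from `s'`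
  -- used below lie on the receding half of the path.
  have htt : e t t' ≠ 0 := fun h0 => h.snd_ne hd.toIsBipDist he.toIsBipDist H (he.eq_zero.mp h0)
  have h0 : d s' x ≠ 0 := fun h0 => hxs (hd.eq_zero.mp h0)
  obtain ⟨m, hm⟩ : ∃ m, d s' x = 2 * m := by
    obtain ⟨l, hl⟩ := hd.parity s s' x
    exact ⟨l - d s s', by omega⟩
  have htri := hd.triangle s' s x
  have hs := hd.symm s s'
  have z1 : e t' t' = 0 := he.eq_zero.mpr rfl
  by_cases hmk : 2 * m ≤ k
  · obtain ⟨w, hw1, hw2⟩ := hd.geod (x := s') (y := x) (i := 2 * m - 1) (j := 1) (by omega)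
    have hw3 := hd.dist_of_equidistant hx hm (by omega) hw1 (by omega)
    have s1 := hd.symm s' w
    have s2 := hd.symm s' x
    have hcw : c (w, t') = ω := h.color_of_le H (by simp only [prodDist]; omega)
      (by simp only [prodDist]; omega)
    have hrx : prodDist d e (s, t) (x, t') = k + 1 := by simp only [prodDist]; omega
    have hcx : c (x, t') = c (s', t') := by
      rcases h.color_of_le_right H (v := (x, t')) (by simp only [prodDist]; omega) with h1 | h1
      · rcases h.color_of_eq_left H hrx with h2 | h2
        · exact absurd (h1.symm.trans h2) h.left
        · exact h2
      · exact h1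
    exact ⟨⟨by rw [hcx]; exact h.ne, h.left, by rw [hcx]; exact h.right, hrx, (w, t'), hcw,
      by simp only [prodDist]; omega, by simp only [prodDist]; omega⟩, hcx⟩
  · exfalso
    obtain ⟨u, hu1, hu2⟩ := hd.geod (x := s') (y := x) (i := k + 1) (j := 2 * m - (k + 1))
      (by omega)
    obtain ⟨w, hw1, hw2⟩ := hd.geod (x := s') (y := u) (i := k) (j := 1) hu1
    have hu3 := hd.dist_of_equidistant hx hm (by omega) hu1 (by omega)
    have t1 := hd.triangle w u x
    have t2 := hd.triangle s' w x
    have hw3 := hd.dist_of_equidistant hx hm (by omega) hw1 (by omega)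
    have s1 := hd.symm s' w
    have s2 := hd.symm s' u
    have hcw : c (w, t') = ω := h.color_of_le H (by simp only [prodDist]; omega)
      (by simp only [prodDist]; omega)
    have hcu : c (u, t') = c (s, t) := by
      rcases h.color_of_eq_right H (v := (u, t')) (by simp only [prodDist]; omega) with h1 | h1
      · exact h1
      · rcases h.color_of_le_left H (v := (u, t')) (by simp only [prodDist]; omega) with h2 | h2
        · exact absurd (h2.symm.trans h1) h.right
        · exact h2
    have hg : GoodPair (prodDist d e) c k ω (s', t') (u, t') :=
      ⟨by rw [hcu]; exact h.ne.symm, h.right, by rw [hcu]; exact h.left,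
        by simp only [prodDist]; omega, (w, t'), hcw, by simp only [prodDist]; omega,
        by simp only [prodDist]; omega⟩
    exact hg.snd_ne hd.toIsBipDist he.toIsBipDist H rfl

theorem GoodPair.snd_move [Nontrivial V] (hd : IsTreeDist d) (he : IsTreeDist e)
    (H : GapColoring (prodDist d e) c k) {s s' : V} {t t' y : W}
    (h : GoodPair (prodDist d e) c k ω (s, t) (s', t')) (hy : e t y = e t t') :
    GoodPair (prodDist d e) c k ω (s, t) (s', y) ∧ c (s', y) = c (s', t') := by
  obtain ⟨h1, h2⟩ := GoodPair.fst_move he hd (H.swap hd.toIsBipDist he.toIsBipDist) h.swap hy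
  exact ⟨h1.swap, h2⟩

/-- For a fixed splitting of `k + 1` between the factors, `fst_move` and `snd_move` reach
everything. One unit passes from the second factor to the first through a common neighbor. -/
theorem GoodPair.sphere_of_le [Nontrivial V] [Nontrivial W] (hd : IsTreeDist d)
    (he : IsTreeDist e) (H : GapColoring (prodDist d e) c k) {s x : V} {t y : W}
    (hxy : d s x + e t y = k + 1) :
    ∀ n s' t', GoodPair (prodDist d e) c k ω (s, t) (s', t') → d s x = d s s' + n →
      GoodPair (prodDist d e) c k ω (s, t) (x, y) ∧ c (x, y) = c (s', t') := by
  intro n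
  induction n with
  | zero =>
    intro s' t' h hx
    have hdist := h.dist
    simp only [prodDist] at hdist
    obtain ⟨h1, c1⟩ := h.fst_move hd he H hx
    obtain ⟨h2, c2⟩ := h1.snd_move hd he H (y := y) (by omega)
    exact ⟨h2, c2.trans c1⟩
  | succ n ih =>
    intro s' t' h hx
    have hdist := h.dist
    simp only [prodDist] at hdist
    obtain ⟨s₂, h3, h4⟩ := hd.geod (x := s) (y := x) (i := d s s' + 1) (j := n) (by omega)
    obtain ⟨s₁, h5, h6⟩ := hd.geod h3
    obtain ⟨t₁, h7, h8⟩ := he.geod (x := t) (y := t') (i := e t t' - 1) (j := 1) (by omega)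
    obtain ⟨g1, c1⟩ := h.fst_move hd he H h5
    have z1 : e t' t' = 0 := he.eq_zero.mpr rfl
    have z2 : d s₁ s₁ = 0 := hd.eq_zero.mpr rfl
    have z3 : e t₁ t₁ = 0 := he.eq_zero.mpr rfl
    have e1 := he.symm t' t₁
    obtain ⟨g2, c2⟩ := g1.of_common_neighbor H (w := (s₁, t₁)) (v := (s₂, t₁))
      (by simp only [prodDist]; omega) (by simp only [prodDist]; omega)
      (by simp only [prodDist]; omega) (by simp only [prodDist]; omega)
    obtain ⟨g3, c3⟩ := ih s₂ t₁ g2 (by omega)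
    exact ⟨g3, c3.trans (c2.trans c1)⟩

/-- A vertex forms a good pair with all vertices at distance `k + 1` as soon as it does so with one
of them. -/
theorem GoodPair.sphere [Nontrivial V] [Nontrivial W] (hd : IsTreeDist d)
    (he : IsTreeDist e) (H : GapColoring (prodDist d e) c k) {s s' x : V} {t t' y : W}
    (h : GoodPair (prodDist d e) c k ω (s, t) (s', t')) (hxy : d s x + e t y = k + 1) :
    GoodPair (prodDist d e) c k ω (s, t) (x, y) ∧ c (x, y) = c (s', t') := by
  have hdist := h.dist
  simp only [prodDist] at hdist
  rcases le_total (d s s') (d s x) with hle | hle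
  · exact h.sphere_of_le hd he H hxy (d s x - d s s') s' t' (by omega)
  · obtain ⟨h1, h2⟩ := GoodPair.sphere_of_le he hd (H.swap hd.toIsBipDist he.toIsBipDist)
      (x := y) (y := x) (s := t) (t := s) (by omega) (e t y - e t t') t' s' h.swap (by omega)
    exact ⟨h1.swap, h2⟩

/-- Otherwise the sphere around `(s, t)` would meet the layer of `s`, giving a good pair with equal
first coordinates. -/
theorem GoodPair.snd_le [Nontrivial V] [Nontrivial W] (hd : IsTreeDist d)
    (he : IsTreeDist e) (H : GapColoring (prodDist d e) c k) {s s' : V} {t t' : W}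
    (h : GoodPair (prodDist d e) c k ω (s, t) (s', t')) (y : W) : e t y ≤ k := by
  by_contra hy
  obtain ⟨z, hz, -⟩ := he.geod (x := t) (y := y) (i := k + 1) (j := e t y - (k + 1)) (by omega)
  have h0 : d s s = 0 := hd.eq_zero.mpr rfl
  have := (h.sphere hd he H (x := s) (y := z) (by omega)).1
  exact this.fst_ne hd.toIsBipDist he.toIsBipDist H rfl

theorem GoodPair.fst_le [Nontrivial V] [Nontrivial W] (hd : IsTreeDist d)
    (he : IsTreeDist e) (H : GapColoring (prodDist d e) c k) {s s' : V} {t t' : W}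
    (h : GoodPair (prodDist d e) c k ω (s, t) (s', t')) (x : V) : d s x ≤ k :=
  GoodPair.snd_le he hd (H.swap hd.toIsBipDist he.toIsBipDist) h.swap x

/-- There is no fourth color. -/
theorem GoodPair.color_eq [Nontrivial V] [Nontrivial W] (hd : IsTreeDist d)
    (he : IsTreeDist e) (H : GapColoring (prodDist d e) c k) {r b : V × W}
    (h : GoodPair (prodDist d e) c k ω r b) (v : V × W) :
    c v = ω ∨ c v = c r ∨ c v = c b := by
  obtain ⟨s, t⟩ := r
  obtain ⟨s', t'⟩ := b
  obtain ⟨x, y⟩ := v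
  have hx := h.fst_le hd he H x
  by_cases hv : d s x + e t y ≤ k
  · rcases h.color_of_le_left H (v := (x, y)) hv with h1 | h1
    · exact Or.inl h1
    · exact Or.inr (Or.inl h1)
  -- `(x, z)` lies on the sphere around `r` and, by `snd_le`, within `k` of `(x, y)`.
  · obtain ⟨z, h1, h2⟩ := he.geod (x := t) (y := y) (i := k + 1 - d s x)
      (j := e t y - (k + 1 - d s x)) (by omega)
    obtain ⟨g, hg⟩ := h.sphere hd he H (x := x) (y := z) (by omega)
    have h3 := (g.symm H).snd_le hd he H y
    have z1 : d x x = 0 := hd.eq_zero.mpr rfl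
    rcases (g.symm H).color_of_le_left H (v := (x, y)) (by simp only [prodDist]; omega) with h4 | h4
    · exact Or.inl h4
    · exact Or.inr (Or.inr (h4.trans hg))

/-- In a tree of diameter `D`, a vertex farthest from some vertex has eccentricity `D`. -/
theorem IsTreeDist.exists_dist_eq_of_farthest (hd : IsTreeDist d) {D : ℕ} (hD : ∃ u v, d u v = D)
    (hle : ∀ u v, d u v ≤ D) {s x : V} (hx : ∀ v, d s v ≤ d s x) : ∃ v, d x v = D := by
  obtain ⟨u, v, huv⟩ := hD
  have f := hd.four s x u v
  have h1 := hx u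
  have h2 := hx v
  have h3 := hle x u
  have h4 := hle x v
  by_cases h : d x u = D
  · exact ⟨u, h⟩
  · exact ⟨v, by omega⟩

theorem exists_farthest {D : ℕ} (hle : ∀ u v, d u v ≤ D) (s : V) :
    ∃ x, ∀ v, d s v ≤ d s x := by
  classical
  have hex : ∃ n, ∃ x, D - d s x = n := ⟨_, s, rfl⟩
  obtain ⟨x, hx⟩ := Nat.find_spec hex
  refine ⟨x, fun v => ?_⟩
  have := Nat.find_min' hex ⟨v, rfl⟩
  have := hle s v
  have := hle s x
  omega

/-- Move one end over the sphere until its first coordinate is farthest from `s`, hence of full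
eccentricity; then move the other end to realize the diameter. -/
theorem GoodPair.exists_diametral [Nontrivial V] [Nontrivial W] (hd : IsTreeDist d)
    (he : IsTreeDist e) (H : GapColoring (prodDist d e) c k) {r b : V × W}
    (h : GoodPair (prodDist d e) c k ω r b) {D : ℕ} (hD : ∃ u v, d u v = D)
    (hle : ∀ u v, d u v ≤ D) :
    ∃ s s' t t', GoodPair (prodDist d e) c k ω (s, t) (s', t') ∧ d s s' = D := by
  obtain ⟨s, t⟩ := r
  obtain ⟨s', t'⟩ := b
  have hdist := h.dist
  simp only [prodDist] at hdist
  obtain ⟨x, hx⟩ := exists_farthest hle s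
  obtain ⟨x', hx'⟩ := hd.exists_dist_eq_of_farthest hD hle hx
  have h1 := hx s'
  have h2 := h.fst_le hd he H x
  obtain ⟨y, hy, -⟩ := he.geod (x := t) (y := t') (i := k + 1 - d s x)
    (j := e t t' - (k + 1 - d s x)) (by omega)
  have g := ((h.sphere hd he H (x := x) (y := y) (by omega)).1).symm H
  have h3 := g.fst_le hd he H x'
  have h4 := hle s x
  have h5 := he.symm t y
  obtain ⟨y', hy', -⟩ := he.geod (x := y) (y := t) (i := k + 1 - D)
    (j := e t y - (k + 1 - D)) (by omega)
  exact ⟨x, x', y, y', (g.sphere hd he H (x := x') (y := y') (by omega)).1, hx'⟩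

end

/-! ### Necessary conditions for three colors -/

/-- `D` is the diameter with respect to the distance `d`. -/
structure IsDiam {V : Type*} (d : V → V → ℕ) (D : ℕ) : Prop where
  exists_eq : ∃ u v, d u v = D
  le : ∀ u v, d u v ≤ D

/-- There are three points pairwise at distance `D`. -/
def HasTriple {V : Type*} (d : V → V → ℕ) (D : ℕ) : Prop :=
  ∃ x y z, d x y = D ∧ d y z = D ∧ d x z = D

/-- The points `s` and `s'` are at distance `D`, all points at distance `D` from `s'` are close to
each other, and so are all points at distance `D - 1` from `s` to `s'`. -/
structure Slim {V : Type*} (d : V → V → ℕ) (D : ℕ) (s s' : V) : Prop where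
  dist : d s s' = D
  near_left : ∀ a, d a s' = D → d a s + 2 ≤ D
  near_right : ∀ y, d y s + 1 = D → d y s' + 2 ≤ D

section

variable {V W κ : Type*} {d : V → V → ℕ} {e : W → W → ℕ} {c : V × W → κ} {k : ℕ} {ω : κ}
  {D D' : ℕ}

theorem IsTreeDist.exists_third (hd : IsTreeDist d) (hD : ∀ u v, d u v ≤ D)
    (h3 : HasTriple d D) {s s' : V} (hs : d s s' = D) : ∃ x, d x s = D ∧ d x s' = D := by
  obtain ⟨x, y, z, hxy, hyz, hxz⟩ := h3
  have e1 := hd.symm s x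
  have e2 := hd.symm s y
  have e3 := hd.symm s z
  have e4 := hd.symm s' x
  have e5 := hd.symm s' y
  have e6 := hd.symm s' z
  have f1 := hd.four x y s s'
  have f2 := hd.four y z s s'
  have f3 := hd.four x z s s'
  have l1 := hD x s
  have l2 := hD y s
  have l3 := hD z s
  have l4 := hD x s'
  have l5 := hD y s'
  have l6 := hD z s'
  by_contra! h
  have h1 := h x
  have h2 := h y
  have h3 := h z
  omega

/-- `(x, t')` lies on the sphere of `(s, t)` and `(x, t)` on that of `(s', t')`, so they have colors
`c b` and `c r`; but they are within `k` of each other. -/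
theorem GoodPair.not_hasTriple [Nontrivial V] [Nontrivial W] (hd : IsTreeDist d)
    (he : IsTreeDist e) (H : GapColoring (prodDist d e) c k) {s s' : V} {t t' : W}
    (h : GoodPair (prodDist d e) c k ω (s, t) (s', t')) {x : V} (h1 : d x s = d s s')
    (h2 : d x s' = d s s') : False := by
  have hdist := h.dist
  simp only [prodDist] at hdist
  have e1 := hd.symm x s
  have e2 := hd.symm x s'
  have e3 := hd.symm s s'
  have e4 := he.symm t t'
  obtain ⟨g1, c1⟩ := h.sphere hd he H (x := x) (y := t') (by omega)
  obtain ⟨g2, c2⟩ := (h.symm H).sphere hd he H (x := x) (y := t) (by omega)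
  have hne : d s s' ≠ 0 := fun h0 =>
    h.fst_ne hd.toIsBipDist he.toIsBipDist H (hd.eq_zero.mp h0)
  have z1 : d x x = 0 := hd.eq_zero.mpr rfl
  rcases g1.color_of_le_right H (v := (x, t)) (by simp only [prodDist]; omega) with h3 | h3
  · exact g2.right h3.symm
  · exact h.ne (by rw [← c2, h3, c1])

/-- The extra unit at `u` compensates for a point at distance `D - 1` instead of `D`, so the
argument for triples also excludes near-triples. -/
theorem GoodPair.slim_of_room [Nontrivial V] [Nontrivial W] (hd : IsTreeDist d)
    (he : IsTreeDist e) (H : GapColoring (prodDist d e) c k) (hD : ∀ u v, d u v ≤ D)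
    {s s' : V} {t t' u : W} (h : GoodPair (prodDist d e) c k ω (s, t) (s', t'))
    (hs : d s s' = D) (hu : e t u = e t t' + 1) : Slim d D s s' := by
  have hdist := h.dist
  simp only [prodDist] at hdist
  have e3 := hd.symm s s'
  have e4 := he.symm t t'
  have e5 := he.symm t u
  have z0 : d s s = 0 := hd.eq_zero.mpr rfl
  have hne : D ≠ 0 := fun h0 =>
    h.fst_ne hd.toIsBipDist he.toIsBipDist H (hd.eq_zero.mp (by omega))
  have hD1 : D ≠ 1 := by
    intro h1
    have g := (h.sphere hd he H (x := s) (y := u) (by omega)).1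
    exact g.fst_ne hd.toIsBipDist he.toIsBipDist H rfl
  have key : ∀ a, d a s' = D → d a s + 2 ≤ D := by
    intro a ha
    by_contra hlt
    have e1 := hd.symm a s
    have e2 := hd.symm a s'
    have l1 := hD a s
    have z1 : d a a = 0 := hd.eq_zero.mpr rfl
    by_cases h1 : d a s = D
    · exact h.not_hasTriple hd he H (x := a) (by omega) (by omega)
    · obtain ⟨g1, c1⟩ := h.sphere hd he H (x := a) (y := u) (by omega)
      obtain ⟨g2, c2⟩ := (h.symm H).sphere hd he H (x := a) (y := t) (by omega)
      rcases g1.color_of_le_right H (v := (a, t)) (by simp only [prodDist]; omega) with h3 | h3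
      · exact g2.right h3.symm
      · exact h.ne (by rw [← c2, h3, c1])
  refine ⟨hs, key, fun y hy => ?_⟩
  by_contra hlt
  have e1 := hd.symm y s
  have e2 := hd.symm y s'
  have l1 := hD y s'
  by_cases h1 : d y s' = D
  · have := key y h1
    omega
  · obtain ⟨g1, c1⟩ := h.sphere hd he H (x := y) (y := u) (by omega)
    obtain ⟨g2, c2⟩ := (g1.symm H).sphere hd he H (x := s') (y := t) (by omega)
    have z1 : d s' s' = 0 := hd.eq_zero.mpr rfl
    rcases h.color_of_le_right H (v := (s', t)) (by simp only [prodDist]; omega) with h3 | h3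
    · exact g2.right h3.symm
    · exact h.ne (by rw [← h3, c2])

/-- A rainbow-free coloring of a product of trees with at least three colors exists only if no
factor has three points pairwise at distance the diameter, and, if the diameter of the product is
even, only if both factors are slim. -/
theorem RainbowFree.necessary [Nontrivial V] [Nontrivial W] (hd : IsTreeDist d)
    (he : IsTreeDist e) (hD : IsDiam d D) (hD' : IsDiam e D') (hc : RainbowFree (prodDist d e) c)
    {x₁ x₂ x₃ : V × W} (h₁₂ : c x₁ ≠ c x₂) (h₁₃ : c x₁ ≠ c x₃) (h₂₃ : c x₂ ≠ c x₃) :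
    ¬ HasTriple d D ∧ (Even (D + D') → ∃ s s', Slim d D s s') := by
  obtain ⟨k, ω, r, b, H, h⟩ :=
    exists_goodPair (hd.toIsBipDist.prodDist he.toIsBipDist) hc h₁₂ h₁₃ h₂₃
  obtain ⟨s, s', t, t', g, hs⟩ := h.exists_diametral hd he H hD.exists_eq hD.le
  refine ⟨fun h3 => ?_, fun hev => ?_⟩
  · obtain ⟨x, h1, h2⟩ := hd.exists_third hD.le h3 hs
    exact g.not_hasTriple hd he H (h1.trans hs.symm) (h2.trans hs.symm)
  · have hdist := g.dist
    simp only [prodDist] at hdist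
    obtain ⟨j, hj⟩ := g.even H
    obtain ⟨l, hl⟩ := hev
    have e1 := he.symm t t'
    by_cases h1 : ∃ u, e t u = e t t' + 1
    · obtain ⟨u, hu⟩ := h1
      exact ⟨s, s', g.slim_of_room hd he H hD.le hs hu⟩
    by_cases h2 : ∃ u, e t' u = e t t' + 1
    · obtain ⟨u, hu⟩ := h2
      exact ⟨s', s, (g.symm H).slim_of_room hd he H hD.le (by rw [hd.symm]; exact hs)
        (by rw [hu, e1])⟩
    -- If no vertex is farther than `e t t'` from `t` or from `t'`, the four-point condition gives
    -- `D' = e t t'`. Then `D + D' = k + 1`, which is odd since `k` is even.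
    exfalso
    have key : ∀ z, (¬ ∃ u, e z u = e t t' + 1) → ∀ u, e z u ≤ e t t' := by
      intro z hz u
      by_contra hu
      obtain ⟨v, hv, -⟩ := he.geod (x := z) (y := u) (i := e t t' + 1)
        (j := e z u - (e t t' + 1)) (by omega)
      exact hz ⟨v, hv⟩
    obtain ⟨u, v, huv⟩ := hD'.exists_eq
    have f := he.four t t' u v
    have a1 := key t h1 u
    have a2 := key t h1 v
    have a3 := key t' h2 u
    have a4 := key t' h2 v
    have a5 := hD'.le t t'
    omega

/-! ### Construction of three-colorings -/

/-- A coloring in two small classes and a large third one. -/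
theorem rainbowFree_of_spheres {X : Type*} {δ : X → X → ℕ} (hδ : IsBipDist δ) {R : Set X} {r₀ : X}
    {m : ℕ} (hm : Odd m) (hR : ∀ r ∈ R, ∀ v, δ r v = m ↔ δ r₀ v = m)
    (hB : ∀ b, δ r₀ b = m → ∀ v, δ b v = m → v ∈ R) [DecidablePred (· ∈ R)] :
    RainbowFree δ (fun v => if v ∈ R then (0 : Fin 3) else if δ r₀ v = m then 1 else 2) := by
  have hRB : ∀ r ∈ R, ∀ b, δ r₀ b = m → δ r b = m := fun r hr b hb => (hR r hr b).mpr hb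
  have hpar : ∀ r ∈ R, ∀ b, δ r₀ b = m → ∀ v, δ r v ≠ δ v b := by
    intro r hr b hb v h
    obtain ⟨j, hj⟩ := hm
    obtain ⟨l, hl⟩ := hδ.parity r v b
    have := hRB r hr b hb
    omega
  -- In a rainbow progression, the middle vertex cannot have color 2, since the other two are at odd
  -- distance `m`. If it is in one of the small classes, the common difference is `m`, which puts
  -- both ends into the other small class.
  intro u v w huvw
  have s1 := hδ.symm u v
  have s2 := hδ.symm v w
  have s3 := hδ.symm u w
  by_cases hu : u ∈ R <;> by_cases hv : v ∈ R <;> by_cases hw : w ∈ R <;>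
    by_cases bu : δ r₀ u = m <;> by_cases bv : δ r₀ v = m <;> by_cases bw : δ r₀ w = m <;>
    simp only [hu, hv, hw, bu, bv, bw, if_true, if_false, true_or, or_true] <;> exfalso
  all_goals first
    | exact hpar u hu w bw v huvw
    | exact hpar w hw u bu v (by omega)
    | exact bw ((hR v hv w).mp (by rw [← huvw, s1]; exact hRB v hv u bu))
    | exact bu ((hR v hv u).mp (by rw [← s1, huvw]; exact hRB v hv w bw))
    | exact hw (hB v bv w (by rw [← huvw]; exact hRB u hu v bv))
    | exact hu (hB v bv u (by rw [← s1, huvw, s2]; exact hRB w hw v bv))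

/-- Since `a` and `s` are at most `D - 2` apart, the four-point condition with `s'` makes them
indistinguishable from any point nearly diametral to either. -/
theorem Slim.dist_eq (hd : IsTreeDist d) (hD : ∀ u v, d u v ≤ D) {s s' a : V}
    (h : Slim d D s s') (ha : d a s' = D) {x : V} (hx : D ≤ d a x + 1 ∨ D ≤ d s x + 1) :
    d a x = d s x := by
  have h1 := h.dist
  have h2 := h.near_left a ha
  have h3 := hD x s'
  have f1 := hd.four a x s s'
  have f2 := hd.four s x a s'
  have e1 := hd.symm a s
  have e2 := hd.symm x s
  have e3 := hd.symm x a
  omega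

theorem Slim.near (hd : IsTreeDist d) (hD : ∀ u v, d u v ≤ D) {s s' y : V}
    (h : Slim d D s s') (hy : d s y + 1 = D) (z : V) :
    d y z + 1 ≤ D ∧ (d y z + 1 = D → d z s' = D) := by
  have e1 := hd.symm s y
  have h1 := h.dist
  have h2 := h.near_right y (by omega)
  have h3 := hD z s'
  have h4 := hD z s
  have h5 := hD y z
  have f1 := hd.four y z s s'
  omega

theorem IsTreeDist.far_of_far (hd : IsTreeDist d) (hD : ∀ u v, d u v ≤ D) (h3 : ¬ HasTriple d D)
    {s s' x z : V} (hs : d s s' = D) (hx : d s x = D) (hz : d x z = D) : d z s' = D := by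
  have h1 := hD z s'
  have h2 := hD z s
  have h4 := hD x s'
  have f1 := hd.four x z s s'
  have e1 := hd.symm x s
  by_contra hne
  exact h3 ⟨x, s, s', by omega, hs, by omega⟩

/-- The radius `D + D' - 1` is the largest odd distance. Vertices on this sphere lose one unit in
exactly one factor: `Slim.near` handles that factor and `far_of_far` the other. -/
theorem exists_rainbowFree_of_slim (hd : IsTreeDist d) (he : IsTreeDist e)
    (hD : IsDiam d D) (hD' : IsDiam e D') (hev : Even (D + D')) {s s' : V} {t t' : W}
    (h : Slim d D s s') (h' : Slim e D' t t') :
    ∃ c : V × W → Fin 3, Function.Surjective c ∧ RainbowFree (prodDist d e) c := by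
  classical
  have z1 : d s s = 0 := hd.eq_zero.mpr rfl
  have z2 : d s' s' = 0 := hd.eq_zero.mpr rfl
  have z3 : e t' t' = 0 := he.eq_zero.mpr rfl
  have n1 := h.near_left s h.dist
  have n2 := h'.near_left t h'.dist
  have hs := h.dist
  have ht := h'.dist
  have e1 := hd.symm s s'
  refine ⟨_, ?_, rainbowFree_of_spheres (hd.toIsBipDist.prodDist he.toIsBipDist)
    (R := {v | d v.1 s' = D ∧ e v.2 t' = D'}) (r₀ := (s, t)) (m := D + D' - 1) ?_ ?_ ?_⟩
  · obtain ⟨z, hz1, hz2⟩ := hd.geod (x := s) (y := s') (i := D - 1) (j := 1) (by omega)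
    intro i
    fin_cases i
    · exact ⟨(s, t), by simp [hs, ht]⟩
    · refine ⟨(z, t'), ?_⟩
      have a1 : ¬ (d z s' = D ∧ e t' t' = D') := by omega
      have a2 : prodDist d e (s, t) (z, t') = D + D' - 1 := by simp only [prodDist]; omega
      simp [a1, a2]
    · refine ⟨(s', t'), ?_⟩
      have a1 : ¬ (d s' s' = D ∧ e t' t' = D') := by omega
      have a2 : ¬ prodDist d e (s, t) (s', t') = D + D' - 1 := by simp only [prodDist]; omega
      simp [a1, a2]
  · obtain ⟨j, hj⟩ := hev
    exact ⟨j - 1, by omega⟩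
  · rintro ⟨a, a'⟩ ⟨ha, ha'⟩ ⟨x, y⟩
    simp only [prodDist] at *
    have l1 := hD.le a x
    have l2 := hD'.le a' y
    have l3 := hD.le s x
    have l4 := hD'.le t y
    have k1 := h.dist_eq hd hD.le ha (x := x)
    have k2 := h'.dist_eq he hD'.le ha' (x := y)
    omega
  · rintro ⟨x, y⟩ hxy ⟨x', y'⟩ hv
    have l1 := hD.le x x'
    have l2 := hD'.le y y'
    have l3 := hD.le s x
    have l4 := hD'.le t y
    simp only [prodDist] at hxy hv
    have hcase : (d s x = D ∧ e t y + 1 = D') ∨ (d s x + 1 = D ∧ e t y = D') := by omega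
    have key1 : ¬ HasTriple d D := fun h3 => by
      obtain ⟨u, hu1, hu2⟩ := hd.exists_third hD.le h3 hs
      have := h.near_left u hu2
      omega
    have key2 : ¬ HasTriple e D' := fun h3 => by
      obtain ⟨u, hu1, hu2⟩ := he.exists_third hD'.le h3 ht
      have := h'.near_left u hu2
      omega
    rcases hcase with ⟨c1, c2⟩ | ⟨c1, c2⟩
    · have k1 := h'.near he hD'.le c2 y'
      exact ⟨hd.far_of_far hD.le key1 hs c1 (show d x x' = D by omega), k1.2 (by omega)⟩
    · have k1 := h.near hd hD.le c1 x'
      exact ⟨k1.2 (by omega), he.far_of_far hD'.le key2 ht c2 (show e y y' = D' by omega)⟩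

theorem IsTreeDist.dist_eq_of_far (hd : IsTreeDist d) (hD : ∀ u v, d u v ≤ D)
    (h3 : ¬ HasTriple d D) {s s' a : V} (hs : d s s' = D) (ha : d a s' = D) {x : V}
    (hx : d a x = D ∨ d s x = D) : d a x = d s x := by
  have e1 := hd.symm a s
  have e2 := hd.symm x s
  have e3 := hd.symm x a
  have h1 := hD a s
  have h2 : d a s ≠ D := fun h => h3 ⟨a, s, s', h, hs, ha⟩
  have h4 := hD x s'
  have h5 := hD a x
  have h6 := hD s x
  have f1 := hd.four a x s s'
  have f2 := hd.four s x a s'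
  omega

/-- Here `D + D'` itself is odd, so the sphere consists of antipodes of `(s, t)` and the absence of
triples suffices. -/
theorem exists_rainbowFree_of_odd [Nontrivial V] [Nontrivial W] (hd : IsTreeDist d)
    (he : IsTreeDist e) (hD : IsDiam d D) (hD' : IsDiam e D') (hodd : Odd (D + D'))
    (h3 : ¬ HasTriple d D) (h3' : ¬ HasTriple e D') :
    ∃ c : V × W → Fin 3, Function.Surjective c ∧ RainbowFree (prodDist d e) c := by
  classical
  obtain ⟨s, s', hs⟩ := hD.exists_eq
  obtain ⟨t, t', ht⟩ := hD'.exists_eq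
  obtain ⟨u, hu⟩ := hd.toIsBipDist.exists_dist_eq_one s
  obtain ⟨u', hu'⟩ := he.toIsBipDist.exists_dist_eq_one t
  have n1 := hD.le s u
  have n2 := hD'.le t u'
  have z1 : e t t = 0 := he.eq_zero.mpr rfl
  have z2 : d s' s' = 0 := hd.eq_zero.mpr rfl
  refine ⟨_, ?_, rainbowFree_of_spheres (hd.toIsBipDist.prodDist he.toIsBipDist)
    (R := {v | d v.1 s' = D ∧ e v.2 t' = D'}) (r₀ := (s, t)) hodd ?_ ?_⟩
  · intro i
    fin_cases i
    · exact ⟨(s, t), by simp [hs, ht]⟩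
    · refine ⟨(s', t'), ?_⟩
      have a1 : ¬ (d s' s' = D ∧ e t' t' = D') := by omega
      have a2 : prodDist d e (s, t) (s', t') = D + D' := by simp only [prodDist]; omega
      simp [a1, a2]
    · refine ⟨(s', t), ?_⟩
      have a1 : ¬ (d s' s' = D ∧ e t t' = D') := by omega
      have a2 : ¬ prodDist d e (s, t) (s', t) = D + D' := by simp only [prodDist]; omega
      simp [a1, a2]
  · rintro ⟨a, a'⟩ ⟨ha, ha'⟩ ⟨x, y⟩
    simp only [prodDist] at *
    have l1 := hD.le a x
    have l2 := hD'.le a' y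
    have l3 := hD.le s x
    have l4 := hD'.le t y
    have k1 := hd.dist_eq_of_far hD.le h3 hs ha (x := x)
    have k2 := he.dist_eq_of_far hD'.le h3' ht ha' (x := y)
    omega
  · rintro ⟨x, y⟩ hxy ⟨x', y'⟩ hv
    have l1 := hD.le x x'
    have l2 := hD'.le y y'
    have l3 := hD.le s x
    have l4 := hD'.le t y
    simp only [prodDist] at hxy hv
    exact ⟨hd.far_of_far hD.le h3 hs (by omega) (show d x x' = D by omega),
      he.far_of_far hD'.le h3' ht (by omega) (show e y y' = D' by omega)⟩

end

/-! ### The metric of a tree -/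

namespace SimpleGraph

variable {V : Type*} {G : SimpleGraph V}

theorem IsTree.length_eq_dist (hG : G.IsTree) {u v : V} {p : G.Walk u v} (hp : p.IsPath) :
    p.length = G.dist u v := by
  obtain ⟨q, hq, hlen⟩ := hG.connected.exists_path_of_dist u v
  have := hG.isAcyclic.subsingleton_path u v
  have hpq : p = q :=
    congrArg Subtype.val (Subsingleton.elim (⟨p, hp⟩ : G.Path u v) ⟨q, hq⟩)
  rw [← hlen, hpq]

theorem Walk.IsPath.exists_subpath {u v w y : V} {p : G.Walk u v} (hp : p.IsPath)
    (hw : w ∈ p.support) (hy : y ∈ p.support) :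
    ∃ s : G.Walk w y, s.IsPath ∧ ∀ z ∈ s.support, z ∈ p.support := by
  obtain ⟨q, r, hq, hr, rfl⟩ := hp.mem_support_iff_exists_append.mp hy
  rw [Walk.mem_support_append_iff] at hw
  rcases hw with hw | hw
  · obtain ⟨q₁, q₂, h1, h2, rfl⟩ := hq.mem_support_iff_exists_append.mp hw
    exact ⟨q₂, h2, fun z hz => by simp [Walk.mem_support_append_iff, hz]⟩
  · obtain ⟨q₁, q₂, h1, h2, rfl⟩ := hr.mem_support_iff_exists_append.mp hw
    refine ⟨q₁.reverse, h1.reverse, fun z hz => ?_⟩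
    rw [Walk.support_reverse, List.mem_reverse] at hz
    simp [Walk.mem_support_append_iff, hz]

/-- Every vertex `x` of a tree has a gate on every path. -/
theorem IsTree.exists_gate (hG : G.IsTree) {a b : V} {p : G.Walk a b} (hp : p.IsPath) (x : V) :
    ∃ w ∈ p.support, ∀ y ∈ p.support, G.dist x y = G.dist x w + G.dist w y := by
  classical
  obtain ⟨w, hw, hmin⟩ := p.support.toFinset.exists_min_image (fun v => G.dist x v)
    ⟨a, by simp⟩
  rw [List.mem_toFinset] at hw
  refine ⟨w, hw, fun y hy => ?_⟩
  obtain ⟨s, hs, hsub⟩ := hp.exists_subpath hw hy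
  obtain ⟨q, hq, hlen⟩ := hG.connected.exists_path_of_dist x w
  -- With `w` the vertex of `p` nearest to `x`, a geodesic from `x` to `w` meets `p` only in `w`, so
  -- continuing along `p` gives a path.
  have hpath : (q.append s).IsPath := by
    rw [Walk.isPath_def, Walk.support_append, List.nodup_append']
    refine ⟨hq.support_nodup, hs.support_nodup.tail, fun v hv hvs => ?_⟩
    have h1 := hmin v (by simpa using hsub v (List.mem_of_mem_tail hvs))
    obtain ⟨q₁, q₂, h2, h3, rfl⟩ := hq.mem_support_iff_exists_append.mp hv
    rw [Walk.length_append, hG.length_eq_dist h2, hG.length_eq_dist h3] at hlen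
    have h4 : v = w := (hG.connected.dist_eq_zero_iff).mp (by omega)
    subst h4
    have := hs.support_nodup
    rw [← Walk.cons_tail_support] at this
    exact (List.nodup_cons.mp this).1 hvs
  rw [← hG.length_eq_dist hpath, Walk.length_append, hG.length_eq_dist hs, hlen]

theorem Connected.exists_dist_eq_of_dist_eq_add (hG : G.Connected) {x y : V} {i j : ℕ}
    (h : G.dist x y = i + j) : ∃ z, G.dist x z = i ∧ G.dist z y = j := by
  obtain ⟨p, hp⟩ := hG.exists_walk_length_eq_dist x y
  refine ⟨p.getVert i, ?_⟩
  have h1 := G.dist_le (p.take i)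
  have h2 := G.dist_le (p.drop i)
  have h3 := hG.dist_triangle (u := x) (v := p.getVert i) (w := y)
  rw [Walk.take_length] at h1
  rw [Walk.drop_length] at h2
  omega

theorem IsTree.dist_add_dist_of_mem_support (hG : G.IsTree) {a b y : V} {p : G.Walk a b}
    (hp : p.IsPath) (hy : y ∈ p.support) : G.dist a y + G.dist y b = G.dist a b := by
  obtain ⟨q, r, hq, hr, rfl⟩ := hp.mem_support_iff_exists_append.mp hy
  rw [← hG.length_eq_dist hp, Walk.length_append, hG.length_eq_dist hq, hG.length_eq_dist hr]

theorem IsTree.isTreeDist (hG : G.IsTree) : IsTreeDist G.dist where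
  eq_zero := hG.connected.dist_eq_zero_iff
  symm := fun _ _ => G.dist_comm
  triangle := fun _ _ _ => hG.connected.dist_triangle
  geod := hG.connected.exists_dist_eq_of_dist_eq_add
  parity := by
    intro x y z
    obtain ⟨p, hp, -⟩ := hG.connected.exists_path_of_dist x y
    obtain ⟨w, hw, h⟩ := hG.exists_gate hp z
    have h1 := h x p.start_mem_support
    have h2 := h y p.end_mem_support
    have h3 := hG.dist_add_dist_of_mem_support hp hw
    rw [G.dist_comm (u := y) (v := z), G.dist_comm (u := x) (v := z)]
    have h4 := G.dist_comm (u := x) (v := w)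
    exact ⟨G.dist x y + G.dist z w, by omega⟩
  four := by
    intro a b c e
    obtain ⟨p, hp, -⟩ := hG.connected.exists_path_of_dist a b
    obtain ⟨w, hw, h⟩ := hG.exists_gate hp c
    obtain ⟨w', hw', h'⟩ := hG.exists_gate hp e
    have a1 := h a p.start_mem_support
    have a2 := h b p.end_mem_support
    have a3 := h' a p.start_mem_support
    have a4 := h' b p.end_mem_support
    have a5 := hG.dist_add_dist_of_mem_support hp hw
    have a6 := hG.dist_add_dist_of_mem_support hp hw'
    have t1 := hG.connected.dist_triangle (u := c) (v := w) (w := e)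
    have t2 := hG.connected.dist_triangle (u := w) (v := w') (w := e)
    -- The two gates lie on the path from `a` to `b` in one order or the other.
    have key : G.dist a w + G.dist w w' = G.dist a w' ∨
        G.dist a w' + G.dist w w' = G.dist a w := by
      obtain ⟨q, r, hq, hr, rfl⟩ := hp.mem_support_iff_exists_append.mp hw
      rw [Walk.mem_support_append_iff] at hw'
      rcases hw' with hw' | hw'
      · right
        rw [G.dist_comm (u := w)]
        exact hG.dist_add_dist_of_mem_support hq hw'
      · left
        have := hG.dist_add_dist_of_mem_support hr hw'
        omega
    have s1 := G.dist_comm (u := a) (v := c)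
    have s2 := G.dist_comm (u := b) (v := e)
    have s3 := G.dist_comm (u := a) (v := e)
    have s4 := G.dist_comm (u := b) (v := c)
    have s5 := G.dist_comm (u := a) (v := w)
    have s6 := G.dist_comm (u := a) (v := w')
    have s7 := G.dist_comm (u := w') (v := e)
    rcases key with h | h <;> omega

theorem Connected.isDiam [Finite V] (hG : G.Connected) : IsDiam G.dist G.diam := by
  have := hG.nonempty
  exact ⟨G.exists_dist_eq_diam, fun u v => dist_le_diam (connected_iff_ediam_ne_top.mp hG)⟩

theorem dist_eq_of_isDiam [Finite V] (hG : G.Connected) {D : ℕ} (h : IsDiam G.dist D) :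
    G.diam = D := by
  obtain ⟨u, v, huv⟩ := h.exists_eq
  obtain ⟨x, y, hxy⟩ := hG.isDiam.exists_eq
  have := hG.isDiam.le u v
  have := h.le x y
  omega

theorem isNPeripheral_three (hD : G.diam ≠ 0) :
    G.IsNPeripheral 3 ↔ HasTriple G.dist G.diam := by
  constructor
  · rintro ⟨u, -, h⟩
    exact ⟨u 0, u 1, u 2, h 0 1 (by decide), h 1 2 (by decide), h 0 2 (by decide)⟩
  · rintro ⟨x, y, z, hxy, hyz, hxz⟩
    have key : ∀ i j : Fin 3, i ≠ j → G.dist (![x, y, z] i) (![x, y, z] j) = G.diam := by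
      intro i j hij
      fin_cases i <;> fin_cases j <;> first | exact absurd rfl hij | skip
      · exact hxy
      · exact hxz
      · exact G.dist_comm.trans hxy
      · exact hyz
      · exact G.dist_comm.trans hxz
      · exact G.dist_comm.trans hyz
    refine ⟨![x, y, z], fun i j hij => ?_, key⟩
    by_contra hne
    have h1 := key i j hne
    rw [hij, dist_self] at h1
    exact hD h1.symm

theorem IsNPeripheral.hasTriple (h : G.IsNPeripheral 3) : HasTriple G.dist G.diam := by
  obtain ⟨u, -, h⟩ := h
  exact ⟨u 0, u 1, u 2, h 0 1 (by decide), h 1 2 (by decide), h 0 2 (by decide)⟩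

theorem Connected.diam_ne_zero [Finite V] [Nontrivial V] (hG : G.Connected) : G.diam ≠ 0 :=
  connected_iff_diam_ne_zero.mp hG

theorem IsTree.nonempty_iso_pathGraph_two_iff [Finite V] [Nontrivial V] (hG : G.IsTree) :
    Nonempty (G ≃g pathGraph 2) ↔ G.diam = 1 := by
  rw [diam_eq_one]
  constructor
  · rintro ⟨f⟩
    ext u v
    have htop : ∀ a b : Fin 2, (pathGraph 2).Adj a b ↔ a ≠ b := fun a b => by
      rw [pathGraph_two_eq_top, top_adj]
    rw [← f.map_adj_iff, htop, f.injective.ne_iff, top_adj]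
  · intro htop
    have hdist : ∀ u v, u ≠ v → G.dist u v = 1 := by
      intro u v huv
      rw [htop, dist_top_of_ne huv]
    obtain ⟨x, y, hxy⟩ := exists_pair_ne V
    have hall : ∀ z, z = x ∨ z = y := by
      intro z
      by_contra! hz
      obtain ⟨m, hm⟩ := hG.isTreeDist.parity x y z
      rw [hdist x y hxy, hdist y z hz.2.symm, hdist x z hz.1.symm] at hm
      omega
    have hbij : Function.Bijective (![x, y] : Fin 2 → V) := by
      constructor
      · intro i j hij
        fin_cases i <;> fin_cases j <;> simp_all
      · intro z
        rcases hall z with h | h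
        · exact ⟨0, h.symm⟩
        · exact ⟨1, h.symm⟩
    rw [pathGraph_two_eq_top, htop]
    exact ⟨Iso.completeGraph (Equiv.ofBijective _ hbij).symm⟩

end SimpleGraph

/-! ### Slim pairs, removed vertices and added leaves -/

namespace SimpleGraph

variable {V : Type*} {G : SimpleGraph V}

/-- An induced subgraph on a geodesically convex set has the distances of the graph. -/
theorem Connected.exists_walk_comap_of_convex (hG : G.Connected) {p : V → Prop}
    (hp : ∀ x y z, p x → p y → G.dist x z + G.dist z y = G.dist x y → p z) :
    ∀ n (x y : {v // p v}), G.dist x y = n →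
      ∃ w : (G.comap (Subtype.val : {v // p v} → V)).Walk x y, w.length = n := by
  intro n
  induction n with
  | zero =>
    intro x y h
    have : x = y := Subtype.ext (hG.dist_eq_zero_iff.mp h)
    subst this
    exact ⟨Walk.nil, rfl⟩
  | succ n ih =>
    intro x y h
    obtain ⟨z, hz1, hz2⟩ := hG.exists_dist_eq_of_dist_eq_add (i := 1) (j := n)
      (by rw [h, add_comm])
    obtain ⟨w, hw⟩ := ih ⟨z, hp x y z x.2 y.2 (by omega)⟩ y hz2
    have hadj : (G.comap (Subtype.val : {v // p v} → V)).Adj x ⟨z, hp x y z x.2 y.2 (by omega)⟩ := by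
      rw [comap_adj]
      exact dist_eq_one_iff_adj.mp hz1
    exact ⟨Walk.cons hadj w, by simp [hw]⟩

theorem Connected.dist_comap_of_convex (hG : G.Connected) {p : V → Prop}
    (hp : ∀ x y z, p x → p y → G.dist x z + G.dist z y = G.dist x y → p z) (x y : {v // p v}) :
    (G.comap (Subtype.val : {v // p v} → V)).dist x y = G.dist x y := by
  obtain ⟨w, hw⟩ := hG.exists_walk_comap_of_convex hp _ x y rfl
  refine le_antisymm (hw ▸ dist_le w) ?_
  obtain ⟨w', hw'⟩ := w.reachable.exists_walk_length_eq_dist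
  rw [← hw', ← Walk.length_map (Hom.comap (Subtype.val : {v // p v} → V) G) w']
  exact dist_le _

theorem IsTree.convex_dist_ne_diam [Finite V] (hG : G.IsTree) (s : V) (x y z : V)
    (hx : G.dist s x ≠ G.diam) (hy : G.dist s y ≠ G.diam)
    (hz : G.dist x z + G.dist z y = G.dist x y) : G.dist s z ≠ G.diam := by
  intro h
  have h1 := hG.connected.isDiam.le s x
  have h2 := hG.connected.isDiam.le s y
  have f := hG.isTreeDist.four s z x y
  have e1 := G.dist_comm (u := x) (v := z)
  omega

theorem IsTree.dist_removeDiametral [Finite V] (hG : G.IsTree) (s : V)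
    (x y : {w : V // G.dist s w ≠ G.diam}) : (G.removeDiametral s).dist x y = G.dist x y :=
  hG.connected.dist_comap_of_convex (hG.convex_dist_ne_diam s) x y

theorem IsTree.isTree_removeDiametral [Finite V] [Nontrivial V] (hG : G.IsTree) (s : V) :
    (G.removeDiametral s).IsTree where
  connected := by
    have : Nonempty {w : V // G.dist s w ≠ G.diam} :=
      ⟨⟨s, by rw [dist_self]; exact hG.connected.diam_ne_zero.symm⟩⟩
    exact ⟨fun x y => (hG.connected.exists_walk_comap_of_convex
      (hG.convex_dist_ne_diam s) _ x y rfl).choose.reachable⟩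
  isAcyclic := hG.isAcyclic.of_comap (Function.Embedding.subtype _)

theorem IsTree.diam_removeDiametral [Finite V] [Nontrivial V] (hG : G.IsTree) {s s' : V}
    (hs : G.dist s s' = G.diam) : (G.removeDiametral s).diam + 1 = G.diam := by
  have h0 := hG.connected.diam_ne_zero
  obtain ⟨z, hz, -⟩ := hG.connected.exists_dist_eq_of_dist_eq_add (x := s) (y := s')
    (i := G.diam - 1) (j := 1) (by omega)
  rw [dist_eq_of_isDiam (hG.isTree_removeDiametral s).connected (D := G.diam - 1)]
  · omega
  · refine ⟨⟨⟨s, by rw [dist_self]; exact h0.symm⟩, ⟨z, by omega⟩, ?_⟩, ?_⟩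
    · rw [hG.dist_removeDiametral]
      exact hz
    · rintro ⟨u, hu⟩ ⟨v, hv⟩
      rw [hG.dist_removeDiametral]
      dsimp only
      have h1 := hG.connected.isDiam.le s u
      have h2 := hG.connected.isDiam.le s v
      have h3 := hG.connected.isDiam.le s' u
      have h4 := hG.connected.isDiam.le s' v
      have f := hG.isTreeDist.four u v s s'
      have e1 := G.dist_comm (u := s) (v := u)
      have e2 := G.dist_comm (u := s) (v := v)
      have e3 := G.dist_comm (u := s') (v := u)
      have e4 := G.dist_comm (u := s') (v := v)
      omega

/-- A triple would supply a third point `x` for the pair formed by `s` and the neighbor `z` of `s'`.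
Then `x` is at distance `D - 1` from both, and the four-point condition contradicts `near_right`. -/
theorem IsTree.not_isNPeripheral_removeDiametral [Finite V] [Nontrivial V] (hG : G.IsTree)
    {s s' : V} (h : Slim G.dist G.diam s s') : ¬ (G.removeDiametral s).IsNPeripheral 3 := by
  intro h3
  have hT := hG.isTree_removeDiametral s
  have hD := hG.diam_removeDiametral h.dist
  have hn := h.near_left s h.dist
  rw [dist_self] at hn
  obtain ⟨z, hz1, hz2⟩ := hG.connected.exists_dist_eq_of_dist_eq_add (x := s) (y := s')
    (i := G.diam - 1) (j := 1) (by rw [h.dist]; omega)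
  obtain ⟨⟨x, hx⟩, h1, h2⟩ := hT.isTreeDist.exists_third hT.connected.isDiam.le h3.hasTriple
    (s := ⟨s, by rw [dist_self]; omega⟩) (s' := ⟨z, by omega⟩)
    (by rw [hG.dist_removeDiametral]; dsimp only; omega)
  rw [hG.dist_removeDiametral] at h1 h2
  dsimp only at h1 h2
  have h4 := h.near_right x (by omega)
  have f := hG.isTreeDist.four s s' z x
  have e1 := G.dist_comm (u := s) (v := x)
  have e2 := G.dist_comm (u := s') (v := x)
  have e3 := G.dist_comm (u := s') (v := z)
  have e4 := G.dist_comm (u := x) (v := z)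
  have e5 := h.dist
  omega

/-- By parity, a failure of `near_left` means `d a s = D - 1`; then `s`, `a` and the neighbor `z` of
`s'` form a triple after the removal. A failure of `near_right` reduces, by parity, to one of
`near_left`. -/
theorem IsTree.slim_of_odd [Finite V] [Nontrivial V] (hG : G.IsTree) (hodd : Odd G.diam)
    (h1 : G.diam ≠ 1) {s s' : V} (hs : G.dist s s' = G.diam)
    (h3 : ¬ (G.removeDiametral s).IsNPeripheral 3) : Slim G.dist G.diam s s' := by
  have hT := hG.isTree_removeDiametral s
  have hD := hG.diam_removeDiametral hs
  have h0 := hG.connected.diam_ne_zero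
  have hle := hG.connected.isDiam.le
  obtain ⟨j, hj⟩ := hodd
  rw [isNPeripheral_three (by omega)] at h3
  have key : ∀ a, G.dist a s' = G.diam → G.dist a s + 2 ≤ G.diam := by
    intro a ha
    obtain ⟨l, hl⟩ := hG.isTreeDist.parity a s' s
    have e1 := G.dist_comm (u := s) (v := s')
    have l1 := hle a s
    by_contra hlt
    obtain ⟨z, hz1, hz2⟩ := hG.connected.exists_dist_eq_of_dist_eq_add (x := s) (y := s')
      (i := G.diam - 1) (j := 1) (by omega)
    have t := hG.isTreeDist.triangle a z s'
    have l2 := hle a z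
    obtain ⟨l', hl'⟩ := hG.isTreeDist.parity a z s'
    have e2 := G.dist_comm (u := a) (v := s)
    refine h3 ⟨⟨s, by rw [dist_self]; omega⟩, ⟨a, by omega⟩, ⟨z, by omega⟩, ?_, ?_, ?_⟩ <;>
      rw [hG.dist_removeDiametral] <;> dsimp only <;> omega
  refine ⟨hs, key, fun y hy => ?_⟩
  obtain ⟨l, hl⟩ := hG.isTreeDist.parity y s s'
  have l1 := hle y s'
  by_contra hlt
  have := key y (by omega)
  omega

theorem addLeaf_adj_some {u a b : V} : (G.addLeaf u).Adj (some a) (some b) ↔ G.Adj a b := by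
  rw [addLeaf, sup_adj, edge_adj, map_adj]
  simp

theorem addLeaf_adj_none {u b : V} : (G.addLeaf u).Adj none (some b) ↔ b = u := by
  rw [addLeaf, sup_adj, edge_adj, map_adj]
  simp

theorem Walk.le_add_length {f : V → ℕ} (hf : ∀ x y, G.Adj x y → f y ≤ f x + 1) {x y : V}
    (p : G.Walk x y) : f y ≤ f x + p.length := by
  induction p with
  | nil => simp
  | cons h p ih =>
    have := hf _ _ h
    rw [Walk.length_cons]
    omega

/-- The graph as a subgraph of the graph with an added leaf. -/
def homAddLeaf (G : SimpleGraph V) (u : V) : G →g G.addLeaf u where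
  toFun := some
  map_rel' := fun h => addLeaf_adj_some.mpr h

theorem Connected.addLeaf (hG : G.Connected) (u : V) : (G.addLeaf u).Connected := by
  have h : ∀ x, (G.addLeaf u).Reachable (some u) x := by
    rintro (_ | x)
    · exact (Adj.reachable (addLeaf_adj_none.mpr rfl)).symm
    · exact (hG.preconnected u x).map (G.homAddLeaf u)
  exact ⟨fun x y => (h x).symm.trans (h y)⟩

theorem Connected.le_dist_addLeaf (hG : G.Connected) (u a : V) (x : Option V) :
    x.elim (G.dist a u + 1) (G.dist a) ≤ (G.addLeaf u).dist (some a) x := by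
  obtain ⟨p, hp⟩ := (hG.addLeaf u).exists_walk_length_eq_dist (some a) x
  have := p.le_add_length (f := fun x => x.elim (G.dist a u + 1) (G.dist a)) (by
    rintro (_ | x) (_ | y) h
    · exact absurd rfl h.ne
    · rw [addLeaf_adj_none.mp h]
      simp only [Option.elim]
      omega
    · rw [addLeaf_adj_none.mp h.symm]
      simp only [Option.elim]
      omega
    · have h1 := dist_eq_one_iff_adj.mpr (addLeaf_adj_some.mp h)
      have := hG.dist_triangle (u := a) (v := x) (w := y)
      simp only [Option.elim]
      omega)
  simp only [Option.elim_some, dist_self, zero_add] at this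
  omega

theorem Connected.dist_addLeaf_some (hG : G.Connected) (u a b : V) :
    (G.addLeaf u).dist (some a) (some b) = G.dist a b := by
  refine le_antisymm ?_ (hG.le_dist_addLeaf u a (some b))
  obtain ⟨p, hp⟩ := hG.exists_walk_length_eq_dist a b
  rw [← hp, ← Walk.length_map (G.homAddLeaf u) p]
  exact dist_le _

theorem Connected.dist_addLeaf_none (hG : G.Connected) (u a : V) :
    (G.addLeaf u).dist none (some a) = G.dist u a + 1 := by
  rw [dist_comm, G.dist_comm]
  refine le_antisymm ?_ (hG.le_dist_addLeaf u a none)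
  have h1 := (hG.addLeaf u).dist_triangle (u := some a) (v := some u) (w := none)
  have h2 : (G.addLeaf u).dist (some u) none = 1 :=
    dist_eq_one_iff_adj.mpr (addLeaf_adj_none.mpr rfl).symm
  rw [hG.dist_addLeaf_some, h2] at h1
  exact h1

/-- A new triple must use the leaf. Conversely, the four-point condition shows that such a `u` has
eccentricity below the diameter, so the leaf does not increase the diameter. -/
theorem IsTree.isNPeripheral_addLeaf_iff [Finite V] [Nontrivial V] (hG : G.IsTree)
    (h3 : ¬ HasTriple G.dist G.diam) (u : V) :
    (G.addLeaf u).IsNPeripheral 3 ↔ ∃ s s', G.dist s s' = G.diam ∧ G.dist u s + 1 = G.diam ∧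
      G.dist u s' + 1 = G.diam := by
  have hC := hG.connected
  have hL := hC.addLeaf u
  have hle := hC.isDiam.le
  have hge : G.diam ≤ (G.addLeaf u).diam := by
    obtain ⟨x, y, hxy⟩ := hC.isDiam.exists_eq
    rw [← hxy, ← hC.dist_addLeaf_some u]
    exact hL.isDiam.le _ _
  constructor
  · rintro ⟨v, hv, h⟩
    have key : ∀ i j l : Fin 3, i ≠ j → i ≠ l → j ≠ l → v i = none →
        ∃ s s', G.dist s s' = G.diam ∧ G.dist u s + 1 = G.diam ∧ G.dist u s' + 1 = G.diam := by
      intro i j l hij hil hjl hi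
      have h1 := h i j hij
      have h2 := h i l hil
      have h3 := h j l hjl
      have n1 := hv.ne hij
      have n2 := hv.ne hil
      rw [hi] at h1 h2 n1 n2
      obtain ⟨s, hs⟩ := Option.ne_none_iff_exists'.mp n1.symm
      obtain ⟨s', hs'⟩ := Option.ne_none_iff_exists'.mp n2.symm
      rw [hs, hC.dist_addLeaf_none] at h1
      rw [hs', hC.dist_addLeaf_none] at h2
      rw [hs, hs', hC.dist_addLeaf_some] at h3
      have := hle s s'
      exact ⟨s, s', by omega, by omega, by omega⟩
    by_cases h0 : v 0 = none
    · exact key 0 1 2 (by decide) (by decide) (by decide) h0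
    by_cases h1 : v 1 = none
    · exact key 1 0 2 (by decide) (by decide) (by decide) h1
    by_cases h2 : v 2 = none
    · exact key 2 0 1 (by decide) (by decide) (by decide) h2
    obtain ⟨x, hx⟩ := Option.ne_none_iff_exists'.mp h0
    obtain ⟨y, hy⟩ := Option.ne_none_iff_exists'.mp h1
    obtain ⟨z, hz⟩ := Option.ne_none_iff_exists'.mp h2
    have a1 := h 0 1 (by decide)
    have a2 := h 1 2 (by decide)
    have a3 := h 0 2 (by decide)
    rw [hx, hy, hC.dist_addLeaf_some] at a1
    rw [hy, hz, hC.dist_addLeaf_some] at a2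
    rw [hx, hz, hC.dist_addLeaf_some] at a3
    have := hle x y
    exact absurd ⟨x, y, z, by omega, by omega, by omega⟩ h3
  · rintro ⟨s, s', h1, h2, h4⟩
    have hD : (G.addLeaf u).diam = G.diam := by
      refine dist_eq_of_isDiam hL ⟨⟨some s, some s', ?_⟩, ?_⟩
      · rw [hC.dist_addLeaf_some, h1]
      · have hu : ∀ a, G.dist u a + 1 ≤ G.diam := by
          intro a
          have f := hG.isTreeDist.four u a s s'
          have := hle u a
          have := hle a s
          have := hle a s'
          omega
        rintro (_ | a) (_ | b)
        · simp
        · rw [hC.dist_addLeaf_none]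
          exact hu b
        · rw [dist_comm, hC.dist_addLeaf_none]
          exact hu a
        · rw [hC.dist_addLeaf_some]
          exact hle a b
    rw [isNPeripheral_three (by rw [hD]; exact hC.diam_ne_zero)]
    refine ⟨none, some s, some s', ?_, ?_, ?_⟩
    · rw [hC.dist_addLeaf_none, hD, h2]
    · rw [hC.dist_addLeaf_some, hD, h1]
    · rw [hC.dist_addLeaf_none, hD, h4]

theorem Connected.isPeripheral_iff [Finite V] (hG : G.Connected) {s : V} :
    G.IsPeripheral s ↔ ∃ s', G.dist s s' = G.diam := by
  have := hG.nonempty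
  have htop := connected_iff_ediam_ne_top.mp hG
  have hcoe : (G.diam : ℕ∞) = G.ediam := ENat.natCast_toNat htop
  have hd : ∀ x y, (G.dist x y : ℕ∞) = G.edist x y := fun x y =>
    (hG.preconnected x y).coe_dist_eq_edist
  constructor
  · intro h
    obtain ⟨s', hs'⟩ := G.exists_edist_eq_eccent_of_finite s
    refine ⟨s', ?_⟩
    have h' : G.eccent s = G.ediam := h
    rw [h', ← hcoe, ← hd] at hs'
    exact_mod_cast hs'
  · rintro ⟨s', hs'⟩
    refine le_antisymm eccent_le_ediam ?_
    rw [← hcoe, ← hs', hd]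
    exact edist_le_eccent

/-- For even diameter, parity makes `near_left` equivalent to the absence of a third diametral
point, and a failure of `near_right` at `y` says exactly that a leaf at `y` completes a triple. The
path `P₂` is excluded because a slim pair forces diameter at least 2. -/
theorem IsTree.exists_slim_iff [Finite V] [Nontrivial V] (hG : G.IsTree) :
    (∃ s s', Slim G.dist G.diam s s') ↔
      ¬ G.IsNPeripheral 3 ∧ ¬ Nonempty (G ≃g pathGraph 2) ∧ ¬ G.IsWeaklyNonThreePeripheral := by
  have hC := hG.connected
  have hle := hC.isDiam.le
  have h0 := hC.diam_ne_zero
  rw [hG.nonempty_iso_pathGraph_two_iff]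
  constructor
  · rintro ⟨s, s', h⟩
    have hn := h.near_left s h.dist
    rw [dist_self] at hn
    have h3 : ¬ HasTriple G.dist G.diam := by
      intro h3
      obtain ⟨x, h1, h2⟩ := hG.isTreeDist.exists_third hle h3 h.dist
      have := h.near_left x h2
      omega
    refine ⟨fun h => h3 h.hasTriple, by omega, ?_⟩
    rintro ⟨-, ⟨-, hw⟩ | ⟨hev, u, hu⟩⟩
    · exact hG.not_isNPeripheral_removeDiametral h
        (hw s (hC.isPeripheral_iff.mpr ⟨s', h.dist⟩))
    · rw [hG.isNPeripheral_addLeaf_iff h3] at hu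
      obtain ⟨j, hj⟩ := hev
      have hs := h.dist
      -- When the two diametral pairs cross in this way, the four-point condition and parity put `u`
      -- at distance `D - 1` from both `s` and `s'`, against `near_right`. The four-point condition
      -- gives the crossing up to exchanging `a` and `a'`.
      have key : ∀ a a', G.dist a a' = G.diam → G.dist u a + 1 = G.diam →
          G.dist u a' + 1 = G.diam → G.dist a s' = G.diam → G.dist a' s = G.diam → False := by
        intro a a' h1 h2 h4 h5 h6
        have e1 := G.dist_comm (u := a) (v := u)
        have e2 := G.dist_comm (u := a') (v := u)
        have e3 := G.dist_comm (u := a') (v := s')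
        have e4 := G.dist_comm (u := u) (v := s)
        have e5 := G.dist_comm (u := u) (v := s')
        have e6 := G.dist_comm (u := a') (v := s)
        have n1 := h.near_left a h5
        have n2 : G.dist a' s' ≠ G.diam := fun h' => h3 ⟨s, a', s', by omega, by omega, hs⟩
        have l1 := hle u s'
        have l2 := hle u s
        have l3 := hle a' s'
        have f1 := hG.isTreeDist.four a u s s'
        have f2 := hG.isTreeDist.four a' u s s'
        obtain ⟨p1, hp1⟩ := hG.isTreeDist.parity a' s s'
        obtain ⟨p2, hp2⟩ := hG.isTreeDist.parity a s' u
        obtain ⟨p3, hp3⟩ := hG.isTreeDist.parity a' s u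
        have n3 := h.near_right u
        omega
      obtain ⟨a, a', h1, h2, h4⟩ := hu
      have f := hG.isTreeDist.four a a' s s'
      have l1 := hle a s
      have l2 := hle a s'
      have l3 := hle a' s
      have l4 := hle a' s'
      by_cases hc : G.dist a s' = G.diam ∧ G.dist a' s = G.diam
      · exact key a a' h1 h2 h4 hc.1 hc.2
      · exact key a' a (by rw [dist_comm]; exact h1) h4 h2 (by omega) (by omega)
  · rintro ⟨h3, h1, hw⟩
    have h3' := h3
    rw [isNPeripheral_three h0] at h3
    rcases Nat.even_or_odd G.diam with hev | hodd
    · obtain ⟨s, s', hs⟩ := hC.isDiam.exists_eq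
      refine ⟨s, s', hs, fun a ha => ?_, fun y hy => ?_⟩
      · have n1 : G.dist a s ≠ G.diam := fun h => h3 ⟨a, s, s', h, hs, ha⟩
        obtain ⟨j, hj⟩ := hev
        obtain ⟨l, hl⟩ := hG.isTreeDist.parity a s s'
        have := hle a s
        omega
      · have n1 : ¬ G.dist y s' + 1 = G.diam := fun h => hw ⟨h3', Or.inr ⟨hev, y,
          (hG.isNPeripheral_addLeaf_iff h3 y).mpr ⟨s, s', hs, hy, h⟩⟩⟩
        obtain ⟨j, hj⟩ := hev
        obtain ⟨l, hl⟩ := hG.isTreeDist.parity y s s'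
        have := hle y s'
        omega
    · have : ∃ s, G.IsPeripheral s ∧ ¬ (G.removeDiametral s).IsNPeripheral 3 := by
        by_contra! h
        exact hw ⟨h3', Or.inl ⟨hodd, h⟩⟩
      obtain ⟨s, hs, hs3⟩ := this
      obtain ⟨s', hs'⟩ := hC.isPeripheral_iff.mp hs
      exact ⟨s, s', hG.slim_of_odd hodd h1 hs' hs3⟩

end SimpleGraph

/-! ### Maximal numbers of colors and components -/

namespace SimpleGraph

variable {V W : Type*} {G : SimpleGraph V} {H : SimpleGraph W}

/-- The coloring `c` has no rainbow three-term arithmetic progression. -/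
def Avoids (G : SimpleGraph V) {κ : Type*} (c : V → κ) : Prop :=
  ∀ u v w, G.edist u v ≠ ⊤ → G.edist u v = G.edist v w → c u = c v ∨ c v = c w ∨ c u = c w

theorem not_hasRainbowAP_three {r : ℕ} {c : V → Fin r} :
    ¬ G.HasRainbowAP c 3 ↔ G.Avoids c := by
  constructor
  · intro h u v w huv hvw
    by_contra! hne
    refine h ⟨![u, v, w], ⟨(G.edist u v).toNat, ?_⟩, ?_⟩
    · have h1 : G.edist u v = ((G.edist u v).toNat : ℕ∞) := (ENat.natCast_toNat huv).symm
      intro i j hij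
      fin_cases i <;> fin_cases j <;> first | exact absurd hij (by decide) | skip
      · exact h1
      · exact hvw.symm.trans h1
    · intro i j hij
      fin_cases i <;> fin_cases j <;> first | rfl | (exfalso; simp_all)
  · rintro h ⟨v, ⟨d, hd⟩, hinj⟩
    have h1 := hd 0 1 rfl
    have h2 := hd 1 2 rfl
    rcases h (v 0) (v 1) (v 2) (by rw [h1]; exact ENat.natCast_ne_top d) (h1.trans h2.symm) with
      h' | h' | h'
    · exact absurd (hinj h') (by decide)
    · exact absurd (hinj h') (by decide)
    · exact absurd (hinj h') (by decide)

theorem Avoids.comp {κ κ' : Type*} {c : V → κ} (h : G.Avoids c) (f : κ → κ') :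
    G.Avoids (f ∘ c) := by
  intro u v w h1 h2
  rcases h u v w h1 h2 with h' | h' | h' <;> simp [h']

theorem Avoids.comap {κ : Type*} {c : W → κ} (h : H.Avoids c) {f : V → W}
    (hf : ∀ u v, H.edist (f u) (f v) = G.edist u v) : G.Avoids (c ∘ f) := fun u v w h1 h2 =>
  h (f u) (f v) (f w) (by rwa [hf]) (by rwa [hf, hf])

/-- `M` is the largest number of colors of a coloring without rainbow three-term progressions. -/
def IsMaxColors (G : SimpleGraph V) (M : ℕ) : Prop :=
  (∃ c : V → ℕ, G.Avoids c ∧ (Set.range c).ncard = M) ∧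
    ∀ c : V → ℕ, G.Avoids c → (Set.range c).ncard ≤ M

theorem IsMaxColors.congr {M : ℕ} (h : H.IsMaxColors M) (f : V ≃ W)
    (hf : ∀ u v, H.edist (f u) (f v) = G.edist u v) : G.IsMaxColors M := by
  obtain ⟨⟨c, hc, hM⟩, hle⟩ := h
  refine ⟨⟨c ∘ f, hc.comap hf, by rw [f.surjective.range_comp, hM]⟩, fun c' hc' => ?_⟩
  have := hle (c' ∘ f.symm) (hc'.comap fun u v => by simp [← hf])
  rwa [f.symm.surjective.range_comp] at this

theorem ncard_range_of_surjective {r : ℕ} {c : V → Fin r} (hc : Function.Surjective c) :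
    (Set.range fun v => (c v : ℕ)).ncard = r := by
  have : (Set.range fun v => (c v : ℕ)) = Fin.val '' (Set.univ : Set (Fin r)) := by
    rw [← hc.range_eq, ← Set.range_comp]
    rfl
  rw [this, Set.ncard_image_of_injective _ Fin.val_injective, Set.ncard_univ, Nat.card_fin]

/-- Merging colors preserves avoidance, so an avoiding coloring with `M` colors yields surjective
ones with every positive `r ≤ M`. -/
theorem IsMaxColors.antiVanDerWaerden_eq [Finite V] {M : ℕ} (h : G.IsMaxColors M) :
    G.antiVanDerWaerden 3 = M + 1 := by
  obtain ⟨⟨c, hc, hM⟩, hle⟩ := h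
  refine IsLeast.csInf_eq ⟨⟨Nat.succ_pos _, fun c' hc' => ?_⟩, ?_⟩
  · by_contra hr
    have := hle _ ((not_hasRainbowAP_three.mp hr).comp Fin.val)
    have h2 := ncard_range_of_surjective hc'
    change (Set.range fun v => (c' v : ℕ)).ncard ≤ M at this
    omega
  · rintro r ⟨hr, hall⟩
    by_contra hlt
    have e : Set.range c ≃ Fin M := Finite.equivFinOfCardEq hM
    let g : Fin M → Fin r := fun i => if hi : (i : ℕ) < r then ⟨i, hi⟩ else ⟨0, hr⟩
    have hsurj : Function.Surjective (g ∘ e ∘ Set.rangeFactorization c) := by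
      refine Function.Surjective.comp ?_ (e.surjective.comp Set.rangeFactorization_surjective)
      intro i
      exact ⟨⟨i, by omega⟩, by simp [g]⟩
    refine not_hasRainbowAP_three.mpr ?_ (hall _ hsurj)
    refine Avoids.comp (c := Set.rangeFactorization c) (fun u v w h1 h2 => ?_) (g ∘ e)
    simpa [Set.rangeFactorization, Subtype.ext_iff] using hc u v w h1 h2

theorem edist_map_le (f : G →g H) (u v : V) : H.edist (f u) (f v) ≤ G.edist u v := by
  by_cases h : G.edist u v = ⊤
  · simp [h]
  · obtain ⟨w, hw⟩ := exists_walk_of_edist_ne_top h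
    rw [← hw, ← Walk.length_map f w]
    exact edist_le _

theorem ConnectedComponent.edist_toSimpleGraph (C : G.ConnectedComponent) (u v : C) :
    C.toSimpleGraph.edist u v = G.edist u v := by
  refine le_antisymm ?_ (edist_map_le C.toSimpleGraph_hom u v)
  obtain ⟨w, hw⟩ := (C.reachable_of_mem_supp u.2 v.2).exists_walk_length_eq_edist
  have hsub : ∀ x ∈ w.support, x ∈ C.supp := by
    classical
    intro x hx
    have h1 : G.connectedComponentMk u = C := u.2
    rw [ConnectedComponent.mem_supp_iff, ← h1]
    exact (ConnectedComponent.sound (w.takeUntil x hx).reachable).symm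
  have h1 := congrArg Walk.length (w.map_induce hsub)
  rw [Walk.length_map] at h1
  calc C.toSimpleGraph.edist u v ≤ ((w.induce C.supp hsub).length : ℕ∞) :=
        edist_le (G := C.toSimpleGraph) _
    _ = G.edist u v := (congrArg (Nat.cast : ℕ → ℕ∞) h1).trans hw

/-- A progression with finite difference stays in one component. `Nat.pair` makes the palettes of
the components disjoint; the upper bound is subadditivity over the restrictions. -/
theorem isMaxColors_sum [Finite V] [Fintype G.ConnectedComponent] {m : G.ConnectedComponent → ℕ}
    (h : ∀ C : G.ConnectedComponent, C.toSimpleGraph.IsMaxColors (m C)) :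
    G.IsMaxColors (∑ C, m C) := by
  constructor
  · choose c hc hm using fun C => (h C).1
    obtain ⟨ι, hι⟩ := exists_injective_nat G.ConnectedComponent
    let col : V → ℕ := fun v => Nat.pair (ι (G.connectedComponentMk v))
      (c (G.connectedComponentMk v) ⟨v, rfl⟩)
    have hcol : ∀ (C : G.ConnectedComponent) (v : C), col v = Nat.pair (ι C) (c C v) := by
      rintro C ⟨v, rfl⟩
      rfl
    refine ⟨col, ?_, ?_⟩
    · intro u v w h1 h2
      have hv : G.connectedComponentMk v = G.connectedComponentMk u :=
        (ConnectedComponent.sound (edist_ne_top_iff_reachable.mp h1)).symm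
      have hw : G.connectedComponentMk w = G.connectedComponentMk u := by
        rw [← hv]
        exact (ConnectedComponent.sound (edist_ne_top_iff_reachable.mp (h2 ▸ h1))).symm
      have key := hc (G.connectedComponentMk u) ⟨u, rfl⟩ ⟨v, hv⟩ ⟨w, hw⟩
      rw [ConnectedComponent.edist_toSimpleGraph, ConnectedComponent.edist_toSimpleGraph] at key
      rw [hcol _ ⟨u, rfl⟩, hcol _ ⟨v, hv⟩, hcol _ ⟨w, hw⟩]
      rcases key h1 h2 with h' | h' | h' <;> simp [h']
    · have hU : Set.range col = ⋃ C, (Nat.pair (ι C)) '' Set.range (c C) := by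
        ext n
        simp only [Set.mem_range, Set.mem_iUnion, Set.mem_image, exists_exists_eq_and]
        constructor
        · rintro ⟨v, rfl⟩
          exact ⟨_, ⟨v, rfl⟩, (hcol _ ⟨v, rfl⟩).symm⟩
        · rintro ⟨C, v, rfl⟩
          exact ⟨v, hcol C v⟩
      rw [hU, Set.ncard_iUnion_of_finite fun C => (Set.finite_range (c C)).image _,
        finsum_eq_sum_of_fintype]
      · refine Finset.sum_congr rfl fun C _ => ?_
        rw [Set.ncard_image_of_injective, hm]
        intro a b hab
        exact (Nat.pair_eq_pair.mp hab).2
      · intro C C' hne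
        refine Set.disjoint_left.mpr ?_
        rintro _ ⟨a, -, rfl⟩ ⟨b, -, hb⟩
        exact hne (hι (Nat.pair_eq_pair.mp hb).1).symm
  · intro c hc
    have hU : Set.range c = ⋃ C ∈ (Finset.univ : Finset G.ConnectedComponent),
        Set.range fun v : C => c v := by
      ext n
      simp only [Set.mem_range, Set.mem_iUnion, Finset.mem_univ, exists_const]
      constructor
      · rintro ⟨v, rfl⟩
        exact ⟨G.connectedComponentMk v, ⟨v, rfl⟩, rfl⟩
      · rintro ⟨C, v, rfl⟩
        exact ⟨v, rfl⟩
    rw [hU]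
    refine (Finset.set_ncard_biUnion_le _ _).trans (Finset.sum_le_sum fun C _ => ?_)
    exact (h C).2 _ (hc.comap fun u v => (C.edist_toSimpleGraph u v).symm)

theorem Connected.edist_boxProd_eq (hG : G.Connected) (hH : H.Connected) (x y : V × W) :
    (G □ H).edist x y = (prodDist G.dist H.dist x y : ℕ) := by
  rw [edist_boxProd, prodDist, Nat.cast_add, (hG.preconnected _ _).coe_dist_eq_edist,
    (hH.preconnected _ _).coe_dist_eq_edist]

theorem Connected.avoids_boxProd_iff (hG : G.Connected) (hH : H.Connected) {κ : Type*}
    {c : V × W → κ} : (G □ H).Avoids c ↔ RainbowFree (prodDist G.dist H.dist) c := by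
  simp only [Avoids, RainbowFree, hG.edist_boxProd_eq hH, Nat.cast_inj, ne_eq,
    ENat.natCast_ne_top, not_false_eq_true, true_imp_iff]

/-! ### Products of two trees -/

section Trees

variable [Finite V] [Finite W]

theorem Connected.diam_boxProd (hG : G.Connected) (hH : H.Connected) :
    (G □ H).diam = G.diam + H.diam := by
  have hdist : ∀ x y, (G □ H).dist x y = prodDist G.dist H.dist x y := by
    intro x y
    have := ((hG.boxProd hH).preconnected x y).coe_dist_eq_edist
    rw [hG.edist_boxProd_eq hH] at this
    exact_mod_cast this
  apply dist_eq_of_isDiam (hG.boxProd hH)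
  obtain ⟨s, s', hs⟩ := hG.isDiam.exists_eq
  obtain ⟨t, t', ht⟩ := hH.isDiam.exists_eq
  refine ⟨⟨(s, t), (s', t'), ?_⟩, fun u v => ?_⟩
  · rw [hdist, prodDist, hs, ht]
  · rw [hdist, prodDist]
    exact add_le_add (hG.isDiam.le _ _) (hH.isDiam.le _ _)

variable [Nontrivial V] [Nontrivial W]

theorem IsTree.not_threeCase_iff (hG : G.IsTree) (hH : H.IsTree) :
    ¬ ThreeCase G H ↔ (¬ HasTriple G.dist G.diam ∧ ¬ HasTriple H.dist H.diam) ∧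
      (Even (G.diam + H.diam) →
        (∃ s s', Slim G.dist G.diam s s') ∧ ∃ t t', Slim H.dist H.diam t t') := by
  rw [hG.exists_slim_iff, hH.exists_slim_iff, ← isNPeripheral_three hG.connected.diam_ne_zero,
    ← isNPeripheral_three hH.connected.diam_ne_zero, ThreeCase,
    hG.connected.diam_boxProd hH.connected]
  tauto

theorem IsTree.exists_avoids_three (hG : G.IsTree) (hH : H.IsTree) (h : ¬ ThreeCase G H) :
    ∃ c : V × W → Fin 3, Function.Surjective c ∧ (G □ H).Avoids c := by
  rw [hG.not_threeCase_iff hH] at h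
  obtain ⟨⟨h1, h2⟩, h3⟩ := h
  simp only [hG.connected.avoids_boxProd_iff hH.connected]
  rcases Nat.even_or_odd (G.diam + H.diam) with hev | hodd
  · obtain ⟨⟨s, s', hs⟩, t, t', ht⟩ := h3 hev
    exact exists_rainbowFree_of_slim hG.isTreeDist hH.isTreeDist hG.connected.isDiam
      hH.connected.isDiam hev hs ht
  · exact exists_rainbowFree_of_odd hG.isTreeDist hH.isTreeDist hG.connected.isDiam
      hH.connected.isDiam hodd h1 h2

theorem IsTree.not_threeCase_of_avoids (hG : G.IsTree) (hH : H.IsTree) {c : V × W → ℕ}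
    (hc : (G □ H).Avoids c) (h : 2 < (Set.range c).ncard) :
    ¬ ThreeCase G H ∧ (Set.range c).ncard ≤ 3 := by
  rw [hG.connected.avoids_boxProd_iff hH.connected] at hc
  obtain ⟨_, _, _, ⟨x₁, rfl⟩, ⟨x₂, rfl⟩, ⟨x₃, rfl⟩, h₁₂, h₁₃, h₂₃⟩ :=
    (Set.two_lt_ncard_iff (Set.finite_range c)).mp h
  have n1 := hc.necessary hG.isTreeDist hH.isTreeDist hG.connected.isDiam hH.connected.isDiam
    h₁₂ h₁₃ h₂₃
  -- `RainbowFree.necessary` constrains only the first factor; exchanging the factors gives the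
  -- rest.
  have n2 := hc.swap.necessary hH.isTreeDist hG.isTreeDist hH.connected.isDiam hG.connected.isDiam
    (x₁ := x₁.swap) (x₂ := x₂.swap) (x₃ := x₃.swap) (by simpa using h₁₂) (by simpa using h₁₃)
    (by simpa using h₂₃)
  constructor
  · rw [hG.not_threeCase_iff hH]
    exact ⟨⟨n1.1, n2.1⟩, fun hev => ⟨n1.2 hev, n2.2 (by rwa [add_comm])⟩⟩
  · obtain ⟨k, ω, r, b, hgap, hgood⟩ := exists_goodPair
      (hG.isTreeDist.toIsBipDist.prodDist hH.isTreeDist.toIsBipDist) hc h₁₂ h₁₃ h₂₃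
    have hsub : Set.range c ⊆ ({ω, c r, c b} : Finset ℕ) := by
      rintro _ ⟨v, rfl⟩
      simpa using hgood.color_eq hG.isTreeDist hH.isTreeDist hgap v
    refine (Set.ncard_le_ncard hsub (Finset.finite_toSet _)).trans ?_
    rw [Set.ncard_coe_finset]
    exact Finset.card_le_three

theorem IsTree.isMaxColors_two (hG : G.IsTree) (hH : H.IsTree) (h : ThreeCase G H) :
    (G □ H).IsMaxColors 2 := by
  classical
  refine ⟨?_, fun c hc => ?_⟩
  · obtain ⟨v, w, hvw⟩ := exists_pair_ne (V × W)
    refine ⟨fun x => if x = v then 0 else 1, fun x y z _ _ => ?_, ?_⟩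
    · dsimp only
      split_ifs <;> simp
    · have : (Set.range fun x => if x = v then 0 else 1) = ({0, 1} : Set ℕ) := by
        ext n
        simp only [Set.mem_range, Set.mem_insert_iff, Set.mem_singleton_iff]
        constructor
        · rintro ⟨x, rfl⟩
          split_ifs <;> simp
        · rintro (rfl | rfl)
          · exact ⟨v, by simp⟩
          · exact ⟨w, by simp [hvw.symm]⟩
      rw [this, Set.ncard_pair (by decide)]
  · by_contra hlt
    exact (hG.not_threeCase_of_avoids hH hc (by omega)).1 h

theorem IsTree.isMaxColors_three (hG : G.IsTree) (hH : H.IsTree) (h : ¬ ThreeCase G H) :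
    (G □ H).IsMaxColors 3 := by
  refine ⟨?_, fun c hc => ?_⟩
  · obtain ⟨c, hs, hc⟩ := hG.exists_avoids_three hH h
    exact ⟨Fin.val ∘ c, hc.comp Fin.val, ncard_range_of_surjective hs⟩
  · by_contra hlt
    exact hlt (hG.not_threeCase_of_avoids hH hc (by omega)).2

end Trees

/-! ### Components of products of forests -/

section Forests

variable {F₁ : SimpleGraph V} {F₂ : SimpleGraph W}

theorem mem_connectedComponentMk_boxProd (x : V) (y : W) (v : V × W) :
    v ∈ (F₁ □ F₂).connectedComponentMk (x, y) ↔
      v.1 ∈ F₁.connectedComponentMk x ∧ v.2 ∈ F₂.connectedComponentMk y := by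
  simp only [← SetLike.mem_coe]
  exact ConnectedComponent.eq.trans (reachable_boxProd.trans
    (and_congr ConnectedComponent.eq.symm ConnectedComponent.eq.symm))

/-- A component of a Cartesian product is the product of components. -/
def componentBoxProdEquiv (F₁ : SimpleGraph V) (F₂ : SimpleGraph W) (x : V) (y : W) :
    (F₁ □ F₂).connectedComponentMk (x, y) ≃
      F₁.connectedComponentMk x × F₂.connectedComponentMk y where
  toFun v := (⟨v.1.1, ((mem_connectedComponentMk_boxProd x y v.1).mp v.2).1⟩,
    ⟨v.1.2, ((mem_connectedComponentMk_boxProd x y v.1).mp v.2).2⟩)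
  invFun p := ⟨(p.1.1, p.2.1), (mem_connectedComponentMk_boxProd x y _).mpr ⟨p.1.2, p.2.2⟩⟩
  left_inv _ := rfl
  right_inv _ := rfl

theorem IsMaxColors.connectedComponentMk_boxProd {x : V} {y : W} {M : ℕ}
    (h : ((F₁.connectedComponentMk x).toSimpleGraph □
      (F₂.connectedComponentMk y).toSimpleGraph).IsMaxColors M) :
    ((F₁ □ F₂).connectedComponentMk (x, y)).toSimpleGraph.IsMaxColors M := by
  refine h.congr (componentBoxProdEquiv F₁ F₂ x y) fun u v => ?_
  rw [edist_boxProd, ConnectedComponent.edist_toSimpleGraph, ConnectedComponent.edist_toSimpleGraph,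
    ConnectedComponent.edist_toSimpleGraph, edist_boxProd]
  rfl

theorem nontrivial_connectedComponentMk {x : V} (h : ¬ G.IsIsolated x) :
    Nontrivial (G.connectedComponentMk x) := by
  simp only [IsIsolated, not_forall, not_not] at h
  obtain ⟨w, hw⟩ := h
  refine ⟨⟨x, rfl⟩, ⟨w, (ConnectedComponent.sound hw.reachable).symm⟩, fun h' => ?_⟩
  exact hw.ne (congrArg Subtype.val h')

theorem isMaxColors_component [Finite V] [Finite W] (hF₁ : F₁.IsAcyclic) (hF₂ : F₂.IsAcyclic)
    {x : V} {y : W} (hx : ¬ F₁.IsIsolated x) (hy : ¬ F₂.IsIsolated y) [Decidable (ThreeCase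
      (F₁.connectedComponentMk x).toSimpleGraph (F₂.connectedComponentMk y).toSimpleGraph)] :
    ((F₁ □ F₂).connectedComponentMk (x, y)).toSimpleGraph.IsMaxColors
      (if ThreeCase (F₁.connectedComponentMk x).toSimpleGraph
        (F₂.connectedComponentMk y).toSimpleGraph then 2 else 3) := by
  have := nontrivial_connectedComponentMk hx
  have := nontrivial_connectedComponentMk hy
  have hT := hF₁.isTree_connectedComponent (F₁.connectedComponentMk x)
  have hT' := hF₂.isTree_connectedComponent (F₂.connectedComponentMk y)
  apply IsMaxColors.connectedComponentMk_boxProd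
  split_ifs with h
  · exact hT.isMaxColors_two hT' h
  · exact hT.isMaxColors_three hT' h

/-- Components of a Cartesian product correspond to pairs of components. -/
noncomputable def componentPair (C : (F₁ □ F₂).ConnectedComponent) :
    F₁.ConnectedComponent × F₂.ConnectedComponent :=
  (F₁.connectedComponentMk C.out.1, F₂.connectedComponentMk C.out.2)

theorem componentPair_mk (x : V) (y : W) :
    componentPair ((F₁ □ F₂).connectedComponentMk (x, y)) =
      (F₁.connectedComponentMk x, F₂.connectedComponentMk y) := by
  have h : ((F₁ □ F₂).connectedComponentMk (x, y)).out ∈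
      (F₁ □ F₂).connectedComponentMk (x, y) := Quot.out_eq _
  rw [mem_connectedComponentMk_boxProd] at h
  exact Prod.ext h.1 h.2

theorem componentPair_bijective :
    Function.Bijective (componentPair (F₁ := F₁) (F₂ := F₂)) := by
  constructor
  · intro C C'
    induction C using ConnectedComponent.ind with | _ v
    induction C' using ConnectedComponent.ind with | _ v'
    obtain ⟨x, y⟩ := v
    obtain ⟨x', y'⟩ := v'
    rw [componentPair_mk, componentPair_mk]
    intro h
    rw [Prod.mk.injEq] at h
    exact ConnectedComponent.sound (reachable_boxProd.mpr
      ⟨ConnectedComponent.exact h.1, ConnectedComponent.exact h.2⟩)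
  · rintro ⟨C, C'⟩
    induction C using ConnectedComponent.ind with | _ x
    induction C' using ConnectedComponent.ind with | _ y
    exact ⟨_, componentPair_mk x y⟩

end Forests

end SimpleGraph

theorem mainTheorem3 {V₁ V₂ : Type*} [Finite V₁] [Finite V₂]
    (F₁ : SimpleGraph V₁) (F₂ : SimpleGraph V₂)
    (hF₁ : F₁.IsAcyclic) (hF₂ : F₂.IsAcyclic)
    (hiso₁ : ∀ v : V₁, ¬ F₁.IsIsolated v) (hiso₂ : ∀ v : V₂, ¬ F₂.IsIsolated v) :
    (F₁ □ F₂).antiVanDerWaerden 3 =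
        2 * ((F₁ □ F₂).componentsWithAW 3).ncard + 3 * ((F₁ □ F₂).componentsWithAW 4).ncard + 1 ∧
      (∀ (x : V₁) (y : V₂),
        ((F₁ □ F₂).connectedComponentMk (x, y) ∈ (F₁ □ F₂).componentsWithAW 3 ↔
          (F₁.connectedComponentMk x).toSimpleGraph.ThreeCase
            (F₂.connectedComponentMk y).toSimpleGraph) ∧
        ((F₁ □ F₂).connectedComponentMk (x, y) ∈ (F₁ □ F₂).componentsWithAW 4 ↔
          ¬ (F₁.connectedComponentMk x).toSimpleGraph.ThreeCase
            (F₂.connectedComponentMk y).toSimpleGraph)) ∧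
      ((F₁ □ F₂).componentsWithAW 3).ncard =
        {p : F₁.ConnectedComponent × F₂.ConnectedComponent |
          p.1.toSimpleGraph.ThreeCase p.2.toSimpleGraph}.ncard ∧
      ((F₁ □ F₂).componentsWithAW 4).ncard =
        {p : F₁.ConnectedComponent × F₂.ConnectedComponent |
          ¬ p.1.toSimpleGraph.ThreeCase p.2.toSimpleGraph}.ncard := by
  classical
  have := Fintype.ofFinite (F₁ □ F₂).ConnectedComponent
  let P : F₁.ConnectedComponent × F₂.ConnectedComponent → Prop :=
    fun p => p.1.toSimpleGraph.ThreeCase p.2.toSimpleGraph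
  have hmax : ∀ C : (F₁ □ F₂).ConnectedComponent,
      C.toSimpleGraph.IsMaxColors (if P (SimpleGraph.componentPair C) then 2 else 3) := by
    intro C
    induction C using SimpleGraph.ConnectedComponent.ind with | _ v
    obtain ⟨x, y⟩ := v
    rw [SimpleGraph.componentPair_mk]
    exact SimpleGraph.isMaxColors_component hF₁ hF₂ (hiso₁ x) (hiso₂ y)
  have haw : ∀ C : (F₁ □ F₂).ConnectedComponent,
      C.toSimpleGraph.antiVanDerWaerden 3 = (if P (SimpleGraph.componentPair C) then 2 else 3) + 1 :=
    fun C => (hmax C).antiVanDerWaerden_eq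
  have h3 : (F₁ □ F₂).componentsWithAW 3 = SimpleGraph.componentPair ⁻¹' {p | P p} := by
    ext C
    simp only [SimpleGraph.componentsWithAW, Set.mem_ofPred_eq, haw, Set.mem_preimage]
    split_ifs <;> simp_all
  have h4 : (F₁ □ F₂).componentsWithAW 4 = SimpleGraph.componentPair ⁻¹' {p | ¬ P p} := by
    ext C
    simp only [SimpleGraph.componentsWithAW, Set.mem_ofPred_eq, haw, Set.mem_preimage]
    split_ifs <;> simp_all
  have hcard : ∀ S : Set (F₁.ConnectedComponent × F₂.ConnectedComponent),
      (SimpleGraph.componentPair ⁻¹' S).ncard = S.ncard := fun S =>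
    Set.ncard_preimage_of_injective_subset_range SimpleGraph.componentPair_bijective.1
      (by rw [SimpleGraph.componentPair_bijective.2.range_eq]; exact Set.subset_univ S)
  refine ⟨?_, fun x y => ⟨?_, ?_⟩, ?_, ?_⟩
  · rw [(SimpleGraph.isMaxColors_sum hmax).antiVanDerWaerden_eq, Finset.sum_ite, Finset.sum_const,
      Finset.sum_const, h3, h4]
    have e3 : SimpleGraph.componentPair ⁻¹' {p | P p} = ((Finset.univ.filter
      fun C : (F₁ □ F₂).ConnectedComponent => P (SimpleGraph.componentPair C)) : Set _) := by
      ext C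
      simp
    have e4 : SimpleGraph.componentPair ⁻¹' {p | ¬ P p} = ((Finset.univ.filter
      fun C : (F₁ □ F₂).ConnectedComponent => ¬ P (SimpleGraph.componentPair C)) : Set _) := by
      ext C
      simp
    rw [e3, e4, Set.ncard_coe_finset, Set.ncard_coe_finset, smul_eq_mul, smul_eq_mul]
    ring
  · rw [h3, Set.mem_preimage, SimpleGraph.componentPair_mk]
    rfl
  · rw [h4, Set.mem_preimage, SimpleGraph.componentPair_mk]
    rfl
  · rw [h3, hcard]
  · rw [h4, hcard]
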